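/- Let $d>0$ and let $q$ be a real-valued function in $L_1(0,d)$. Solutions of $-u''+qu=\lambda u$ on $[0,d]$ are understood in the Carathéodory sense ($u'$ absolutely continuous, equation a.e.). For $\omega\in\mathbb R$ let $u(\omega,\cdot)$ be the solution of $-u''+qu=\omega^2u$ with $u(\omega,0)=1$, $u'(\omega,0)=-i\omega$. Let $f_0,f_1$ be the solutions of $f''=qf$ with $f_0(0)=1$, $f_0'(0)=0$ and $f_1(0)=0$, $f_1'(0)=1$. Formal powers. For a zero-free solution $f$ of $f''=qf$ on $[0,d]$ put $X^{(0)}=\widetilde X^{(0)}=1$ and, for $n\ge1$, $$X^{(n)}(x)=n\int_0^xX^{(n-1)}(s)\,\bigl(f^2(s)\bigr)^{(-1)^n}ds,\qquad \widetilde X^{(n)}(x)=n\int_0^x\widetilde X^{(n-1)}(s)\,\bigl(f^2(s)\bigr)^{(-1)^{n-1}}ds,$$ and let $\Phi_k[f]=fX^{(k)}$ for odd $k$, $\Phi_k[f]=f\widetilde X^{(k)}$ for even $k$. If $f_0$ has no zero in $[0,d]$, put $\varphi_k=\Phi_k[f_0]$. If $f_0$ has a zero, put, with the zero-free solution $f=f_0+if_1$,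 $\varphi_k=\Phi_k[f]$ for odd $k$ and $\varphi_k=\Phi_k[f]-\frac{i}{k+1}\Phi_{k+1}[f]$ for even $k$. Transmutation kernel. A kernel is a complex-valued function $\mathbf A(x,y)$ such that for every $x\in[0,d]$ one has $\mathbf A(x,\cdot)\in L_1(-\infty,x)\cap L_2(-\infty,x)$ and $$u(\omega,x)=e^{-i\omega x}+\int_{-\infty}^x\mathbf A(x,y)e^{-i\omega y}\,dy\qquad\text{for all }\omega\in\mathbb R.$$ Let $L_n(t)=\sum_{k=0}^n\frac{(-1)^k}{k!}\binom nk t^k$ be the Laguerre polynomials, and let $L_2(0,\infty;e^{-t})$ be the space with norm $\|g\|^2=\int_0^\infty|g(t)|^2e^{-t}dt$. Proposition. A kernel exists. For every kernel $\mathbf A$ and every $x\in[0,d]$, the function $\mathbf a(x,t)=\mathbf A(x,x-t)e^{t}$ belongs to $L_2(0,\infty;e^{-t})$ and has exactly one Fourier–Laguerre expansion $\mathbf a(x,t)=\sum_{n=0}^\infty a_n(x)L_n(t)$ convergent in the norm of this space, that is, $\mathbf A(x,y)=\sum_{n=0}^\infty a_n(x)L_n(x-y)e^{-(x-y)}$.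 Its coefficients are, for all $n\ge0$, $$a_n(x)=\sum_{j=0}^n(-1)^j\bigl(\varphi_j(x)-x^j\bigr)\sum_{k=j}^n(-1)^k\frac{n!}{(n-k)!\,k!\,(k-j)!\,j!}\,x^{k-j}.$$ -/

import Mathlib

open MeasureTheory Set Filter Topology

noncomputable section

namespace FourierLaguerre

/-- `u` is a (Carathéodory) solution on `[0, d]` of `-u'' + q u = lam u` with `u 0 = α` and
`u' 0 = β`: it is continuously differentiable, `u'` is absolutely continuous, and the equation
holds almost everywhere. Here `v` is the derivative `u'`. -/
def SolvesIVP (q : ℝ → ℝ) (d : ℝ) (lam α β : ℂ) (u : ℝ → ℂ) : Prop :=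
  ∃ v : ℝ → ℂ,
    (∀ x ∈ Icc 0 d, HasDerivWithinAt u (v x) (Icc 0 d) x) ∧
    AbsolutelyContinuousOnInterval v 0 d ∧
    (∀ᵐ x : ℝ, x ∈ Ioo 0 d →
      ∃ w : ℂ, HasDerivAt v w x ∧ -w + (q x : ℂ) * u x = lam * u x) ∧
    u 0 = α ∧ v 0 = β

/-- The recursive integrals `X⁽ⁿ⁾` associated with `f`. -/
def recX (f : ℝ → ℂ) : ℕ → ℝ → ℂ
  | 0, _ => 1
  | n + 1, x => ((n + 1 : ℕ) : ℂ) * ∫ s in (0 : ℝ)..x, recX f n s * (f s ^ 2) ^ ((-1 : ℤ) ^ (n + 1))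

/-- The recursive integrals `X̃⁽ⁿ⁾` associated with `f`. -/
def recXtilde (f : ℝ → ℂ) : ℕ → ℝ → ℂ
  | 0, _ => 1
  | n + 1, x => ((n + 1 : ℕ) : ℂ) * ∫ s in (0 : ℝ)..x, recXtilde f n s * (f s ^ 2) ^ ((-1 : ℤ) ^ n)

/-- The formal powers associated with a function `f` without zeros. -/
def formalPower (f : ℝ → ℂ) (k : ℕ) (x : ℝ) : ℂ :=
  if Odd k then f x * recX f k x else f x * recXtilde f k x

open Classical in
/-- The system `φ_k` of formal powers associated with the solution `f₀` of `f'' = q f`,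
`f₀ 0 = 1`, `f₀' 0 = 0`. If `f₀` has no zeros in `[0, d]` it is given by the recursive integrals
of `f₀`. If `f₀` has zeros, these integrals need not exist, and `φ_k` is obtained from the formal
powers of the zero-free complex solution `f = f₀ + i f₁` (where `f₁ 0 = 0`, `f₁' 0 = 1`, so that
`f' 0 = i`). -/
def phi (d : ℝ) (f₀ f₁ : ℝ → ℂ) (k : ℕ) (x : ℝ) : ℂ :=
  if ∀ y ∈ Icc 0 d, f₀ y ≠ 0 then formalPower f₀ k x
  else if Odd k then formalPower (fun y => f₀ y + Complex.I * f₁ y) k x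
  else formalPower (fun y => f₀ y + Complex.I * f₁ y) k x
    - Complex.I / ((k : ℂ) + 1) * formalPower (fun y => f₀ y + Complex.I * f₁ y) (k + 1) x

/-- `A` is a kernel of the transmutation operator: for each `x ∈ [0, d]` the function `A x` is in
`L₁ ∩ L₂` of `(-∞, x)` and `u ω x = e^{-iωx} + ∫_{-∞}^x A(x,y) e^{-iωy} dy` for all real `ω`. -/
def IsTransmutationKernel (d : ℝ) (u : ℝ → ℝ → ℂ) (A : ℝ → ℝ → ℂ) : Prop :=
  ∀ x ∈ Icc 0 d,
    MemLp (A x) 2 (volume.restrict (Iio x)) ∧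
    IntegrableOn (A x) (Iio x) ∧
    ∀ ω : ℝ, u ω x = Complex.exp (-Complex.I * ω * x)
      + ∫ y in Iio x, A x y * Complex.exp (-Complex.I * ω * y)

/-- The measure `e^{-t} dt` on `(0, ∞)`. -/
def laguerreMeasure : Measure ℝ :=
  (volume.restrict (Ioi 0)).withDensity fun t => ENNReal.ofReal (Real.exp (-t))

/-- The Laguerre polynomial `L_n`. -/
def laguerre (n : ℕ) (t : ℝ) : ℝ :=
  ∑ k ∈ Finset.range (n + 1), (-1) ^ k / (k.factorial : ℝ) * (n.choose k : ℝ) * t ^ k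

/-- `g` is in `L₂(0, ∞; e^{-t})` and `g = ∑ c_n L_n` with convergence in the norm of this
space. -/
def HasLaguerreExpansion (g : ℝ → ℂ) (c : ℕ → ℂ) : Prop :=
  MemLp g 2 laguerreMeasure ∧
  Tendsto (fun N : ℕ =>
      eLpNorm (fun t => g t - ∑ n ∈ Finset.range N, c n * (laguerre n t : ℂ)) 2 laguerreMeasure)
    atTop (𝓝 0)

end FourierLaguerre

end

/-! A kernel `K(x, y)` supported in `|y| ≤ x` is built, its moments are identified with the formal
powers, and the Laguerre coefficients are read off from the moments. The kernel solves a wave-type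
integral equation: half the integral of `q` over the diagonal points, plus half the integral of `q
K` over the points, whose forward light cone contains `(x, y)`. Its Neumann series converges for `q`
merely integrable. By Fubini (`integral_kernel_mul`), integrating `K` against a continuous `g` turns
the cone into interval means of `g`, which gives a Volterra equation for `T g = g + ∫ K g`. For `g =
e^{-iωy}` this is the variation-of-constants equation of `u(ω, ·)`. For `g = y^k / k!` it is a
triangular system, also satisfied by `φ_k / k!`: formally, the series in `μ` with these coefficients
solves `w'' = q w + μ² w`, `w(0) = 1`, `w'(0) = μ`. Uniqueness (`volterra_unique`) makes `K` a
kernel and gives `φ_k = x^k + ∫ K(x, y) y^k dy`. Injectivity of the Fourier transform makes any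
kernel equal to `K` almost everywhere on `y < x`. The Laguerre polynomials form an orthonormal
basis, so the expansion exists and its coefficients must be `∫ K(x, y) L_n(x - y) dy`; expanding
`L_n(x - y)` in powers of `y` gives the formula. -/

namespace FourierLaguerre

open scoped ComplexConjugate

/-! ### Absolutely continuous functions and a Gronwall estimate with an integrable weight. -/

section AbsolutelyContinuous

variable {E : Type*} [NormedAddCommGroup E] [NormedSpace ℝ E]

/-- The increments are dominated by those of the primitive of `‖f‖`, which reduces the vector-valued
case to the real one. -/
theorem absolutelyContinuousOnInterval_integral {f : ℝ → E} {a b : ℝ}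
    (h : IntervalIntegrable f volume a b) :
    AbsolutelyContinuousOnInterval (fun x => ∫ t in a..x, f t) a b := by
  have hn := h.norm.absolutelyContinuousOnInterval_intervalIntegral (c := a) (by simp)
  unfold AbsolutelyContinuousOnInterval at hn ⊢
  refine squeeze_zero' (Eventually.of_forall fun _ => Finset.sum_nonneg fun i _ => dist_nonneg)
    ?_ hn
  rw [eventually_inf_principal]
  filter_upwards with J hJ
  refine Finset.sum_le_sum fun i hi => ?_
  have h1 := (hJ.1 i hi).1
  have h2 := (hJ.1 i hi).2
  have i1 : ∀ {y}, y ∈ uIcc a b → IntervalIntegrable f volume a y := fun hy =>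
    h.mono_set (uIcc_subset_uIcc_left hy)
  rw [dist_eq_norm, dist_eq_norm, intervalIntegral.integral_interval_sub_left (i1 h1) (i1 h2),
    intervalIntegral.integral_interval_sub_left (i1 h1).norm (i1 h2).norm]
  exact intervalIntegral.norm_integral_le_abs_integral_norm

/-- `F` is absolutely continuous on `[0, d]` with almost everywhere derivative `f`. -/
structure HasACDeriv (d : ℝ) (F f : ℝ → E) : Prop where
  ac : AbsolutelyContinuousOnInterval F 0 d
  deriv : ∀ᵐ x : ℝ, x ∈ Ioo 0 d → HasDerivAt F (f x) x
  int : IntervalIntegrable f volume 0 d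

namespace HasACDeriv

variable {d : ℝ} {F G f g : ℝ → E}

theorem continuousOn (h : HasACDeriv d F f) (hd : 0 ≤ d) : ContinuousOn F (Icc 0 d) := by
  simpa [uIcc_of_le hd] using h.ac.continuousOn

theorem mono (h : HasACDeriv d F f) {x : ℝ} (hx : x ∈ Icc 0 d) : HasACDeriv x F f where
  ac := h.ac.mono (uIcc_subset_uIcc_left (by rw [uIcc_of_le (hx.1.trans hx.2)]; exact hx))
  deriv := by
    filter_upwards [h.deriv] with y hy hyx
    exact hy ⟨hyx.1, hyx.2.trans_le hx.2⟩
  int := h.int.mono_set (uIcc_subset_uIcc_left (by rw [uIcc_of_le (hx.1.trans hx.2)]; exact hx))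

theorem congr_ae (h : HasACDeriv d F f) (hfg : ∀ᵐ x : ℝ, x ∈ Ioo 0 d → f x = g x)
    (hd : 0 ≤ d) : HasACDeriv d F g where
  ac := h.ac
  deriv := by
    filter_upwards [h.deriv, hfg] with x h1 h2 hx
    rw [← h2 hx]; exact h1 hx
  int := by
    refine h.int.congr_ae ?_
    rw [uIoc_of_le hd, ← restrict_Ioo_eq_restrict_Ioc]
    exact (ae_restrict_iff' measurableSet_Ioo).2 hfg

/-- Subtracting the primitive of `f` leaves an absolutely continuous function with derivative zero
almost everywhere, hence a constant. -/
theorem eq_integral [CompleteSpace E] (h : HasACDeriv d F f) (hd : 0 ≤ d) :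
    F d = F 0 + ∫ t in (0 : ℝ)..d, f t := by
  have hac := h.ac.fun_sub (absolutelyContinuousOnInterval_integral h.int)
  have hd0 : ∀ᵐ x : ℝ, x ∈ uIcc 0 d → HasDerivAt (fun x => F x - ∫ t in (0 : ℝ)..x, f t) 0 x := by
    filter_upwards [h.deriv, h.int.ae_hasDerivAt_integral,
      compl_mem_ae_iff.2 (measure_singleton (0 : ℝ)),
      compl_mem_ae_iff.2 (measure_singleton d)] with x h1 h2 h3 h4 hx
    have hx' := hx
    rw [uIcc_of_le hd] at hx'
    have hx'' : x ∈ Ioo 0 d := ⟨lt_of_le_of_ne hx'.1 (Ne.symm h3), lt_of_le_of_ne hx'.2 h4⟩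
    simpa using (h1 hx'').fun_sub (h2 hx 0 (by simp))
  obtain ⟨C, hC⟩ := hac.const_of_ae_hasDerivAt_zero hd0
  have h0 := hC 0 (by simp)
  have h1 := hC d (by simp)
  simp only [intervalIntegral.integral_same, sub_zero] at h0
  rw [h0, ← h1]; abel

theorem add (hF : HasACDeriv d F f) (hG : HasACDeriv d G g) :
    HasACDeriv d (fun x => F x + G x) (fun x => f x + g x) where
  ac := hF.ac.fun_add hG.ac
  deriv := by
    filter_upwards [hF.deriv, hG.deriv] with x h1 h2 hx
    exact (h1 hx).add (h2 hx)
  int := hF.int.add hG.int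

theorem sub (hF : HasACDeriv d F f) (hG : HasACDeriv d G g) :
    HasACDeriv d (fun x => F x - G x) (fun x => f x - g x) where
  ac := hF.ac.fun_sub hG.ac
  deriv := by
    filter_upwards [hF.deriv, hG.deriv] with x h1 h2 hx
    exact (h1 hx).sub (h2 hx)
  int := hF.int.sub hG.int

theorem const (c : E) : HasACDeriv d (fun _ => c) (fun _ => 0) where
  ac := LipschitzOnWith.absolutelyContinuousOnInterval (K := 0) (LipschitzWith.const c).lipschitzOnWith
  deriv := Eventually.of_forall fun x _ => hasDerivAt_const x c
  int := by simp

theorem sum {ι : Type*} (s : Finset ι) {F f : ι → ℝ → E} (h : ∀ i ∈ s, HasACDeriv d (F i) (f i)) :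
    HasACDeriv d (fun x => ∑ i ∈ s, F i x) (fun x => ∑ i ∈ s, f i x) := by
  classical
  induction s using Finset.induction_on with
  | empty => simpa using const (d := d) (0 : E)
  | insert a s ha ih =>
    simp only [Finset.sum_insert ha]
    exact (h a (by simp)).add (ih fun i hi => h i (by simp [hi]))

theorem of_hasDerivWithinAt (hd : 0 ≤ d) (h : ∀ x ∈ Icc 0 d, HasDerivWithinAt F (f x) (Icc 0 d) x)
    (hf : ContinuousOn f (Icc 0 d)) : HasACDeriv d F f where
  ac := by
    -- For `d = 0` the interval is a point and lacks unique derivatives, so the `C¹` argument does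
    -- not apply.
    rcases hd.eq_or_lt with rfl | hd'
    · refine LipschitzOnWith.absolutelyContinuousOnInterval (K := 0) ?_
      rw [uIcc_self]; exact LipschitzOnWith.of_dist_le_mul (by simp +contextual)
    refine ContDiffOn.absolutelyContinuousOnInterval ?_
    rw [uIcc_of_le hd]
    have hu := uniqueDiffOn_Icc hd'
    refine (contDiffOn_one_iff_derivWithin hu).2 ⟨fun x hx => (h x hx).differentiableWithinAt, ?_⟩
    exact hf.congr fun x hx => (h x hx).derivWithin (hu x hx)
  deriv := Eventually.of_forall fun x hx =>
    (h x (Ioo_subset_Icc_self hx)).hasDerivAt (Icc_mem_nhds hx.1 hx.2)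
  int := by
    refine ContinuousOn.intervalIntegrable ?_
    rwa [uIcc_of_le hd]

theorem of_hasDerivAt (hd : 0 ≤ d) (h : ∀ x, HasDerivAt F (f x) x) (hf : Continuous f) :
    HasACDeriv d F f :=
  of_hasDerivWithinAt hd (fun x _ => (h x).hasDerivWithinAt) hf.continuousOn

theorem integral [CompleteSpace E] (hd : 0 ≤ d) (hf : IntervalIntegrable f volume 0 d) :
    HasACDeriv d (fun x => ∫ t in (0 : ℝ)..x, f t) f where
  ac := absolutelyContinuousOnInterval_integral hf
  deriv := by
    filter_upwards [hf.ae_hasDerivAt_integral] with x hx hx'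
    refine hx ?_ 0 (by simp)
    rw [uIcc_of_le hd]; exact Ioo_subset_Icc_self hx'
  int := hf

theorem mul {𝕜 : Type*} [RCLike 𝕜] {F G f g : ℝ → 𝕜}
    (hF : HasACDeriv d F f) (hG : HasACDeriv d G g) :
    HasACDeriv d (fun x => F x * G x) (fun x => f x * G x + F x * g x) where
  ac := hF.ac.fun_smul hG.ac
  deriv := by
    filter_upwards [hF.deriv, hG.deriv] with x h1 h2 hx
    exact (h1 hx).mul (h2 hx)
  int := (hF.int.mul_continuousOn hG.ac.continuousOn).add
      (hG.int.continuousOn_mul hF.ac.continuousOn)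

theorem const_mul {𝕜 : Type*} [RCLike 𝕜] {F f : ℝ → 𝕜} (c : 𝕜)
    (hF : HasACDeriv d F f) : HasACDeriv d (fun x => c * F x) (fun x => c * f x) := by
  simpa using (const (d := d) c).mul hF

theorem pow {𝕜 : Type*} [RCLike 𝕜] {F f : ℝ → 𝕜} (hF : HasACDeriv d F f) (n : ℕ) :
    HasACDeriv d (fun x => F x ^ (n + 1)) (fun x => (n + 1) * (F x ^ n * f x)) := by
  induction n with
  | zero => simpa using hF
  | succ n ih =>
    convert ih.mul hF using 2 with x
    all_goals push_cast; ring

end HasACDeriv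

/-- Almost everywhere `|q|` is the derivative of its own primitive. This is the source of the
factorials in all iteration bounds below. -/
theorem integral_abs_mul_pow {q : ℝ → ℝ} {d : ℝ} (hd : 0 ≤ d)
    (hq : IntervalIntegrable q volume 0 d) (n : ℕ) :
    ∫ s in (0 : ℝ)..d, |q s| * (∫ t in (0 : ℝ)..s, |q t|) ^ n
      = (∫ t in (0 : ℝ)..d, |q t|) ^ (n + 1) / (n + 1) := by
  have h := ((HasACDeriv.integral hd hq.abs).pow n).eq_integral hd
  simp only [intervalIntegral.integral_same, intervalIntegral.integral_const_mul] at h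
  rw [h]
  have : (n + 1 : ℝ) ≠ 0 := by positivity
  rw [zero_pow (by omega), zero_add, mul_div_cancel_left₀ _ this]
  exact intervalIntegral.integral_congr fun s _ => mul_comm _ _

/-- A bounded function dominated by its own Volterra integral vanishes. -/
theorem eq_zero_of_norm_le_integral {q : ℝ → ℝ} {d : ℝ} (hd : 0 ≤ d)
    (hq : IntervalIntegrable q volume 0 d) {δ : ℝ → ℂ} {k : ℝ → ℝ → ℂ} {B C : ℝ}
    (hB : ∀ x ∈ Icc 0 d, ‖δ x‖ ≤ B) (hk : ∀ x ∈ Icc 0 d, ∀ s ∈ Icc 0 x, ‖k x s‖ ≤ C)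
    (h : ∀ x ∈ Icc 0 d, δ x = ∫ s in (0 : ℝ)..x, (q s : ℂ) * (k x s * δ s)) :
    ∀ x ∈ Icc 0 d, δ x = 0 := by
  have hC : 0 ≤ C := (norm_nonneg _).trans (hk 0 ⟨le_rfl, hd⟩ 0 ⟨le_rfl, le_rfl⟩)
  have hqx : ∀ x ∈ Icc 0 d, IntervalIntegrable q volume 0 x := fun x hx =>
    hq.mono_set (uIcc_subset_uIcc_left (by rw [uIcc_of_le hd]; exact hx))
  -- Each substitution of the equation into itself gains one factor `C ∫ |q|` and one step of the
  -- factorial.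
  have key : ∀ n : ℕ, ∀ x ∈ Icc 0 d,
      ‖δ x‖ ≤ B * ((C * ∫ t in (0 : ℝ)..x, |q t|) ^ n / n.factorial) := by
    intro n
    induction n with
    | zero => intro x hx; simpa using hB x hx
    | succ n ih =>
      intro x hx
      rw [h x hx]
      have hQ := HasACDeriv.integral hx.1 (hqx x hx).abs
      have hi : IntervalIntegrable (fun s => B * C ^ (n + 1) / n.factorial *
          (|q s| * (∫ t in (0 : ℝ)..s, |q t|) ^ n)) volume 0 x :=
        ((hqx x hx).abs.mul_continuousOn (hQ.ac.continuousOn.pow n)).const_mul _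
      refine (intervalIntegral.norm_integral_le_of_norm_le hx.1 ?_ hi).trans ?_
      · refine Eventually.of_forall fun s hs => ?_
        have h1 := ih s ⟨hs.1.le, hs.2.trans hx.2⟩
        have h2 := hk x hx s ⟨hs.1.le, hs.2⟩
        rw [norm_mul, norm_mul, Complex.norm_real, Real.norm_eq_abs]
        calc |q s| * (‖k x s‖ * ‖δ s‖)
            ≤ |q s| * (C * (B * ((C * ∫ t in (0 : ℝ)..s, |q t|) ^ n / n.factorial))) := by gcongr
          _ = _ := by rw [mul_pow]; ring
      · rw [intervalIntegral.integral_const_mul, integral_abs_mul_pow hx.1 (hqx x hx)]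
        apply le_of_eq
        rw [mul_pow, Nat.factorial_succ]
        push_cast
        field_simp
  intro x hx
  have hlim := (FloorSemiring.tendsto_pow_div_factorial_atTop
    (C * ∫ t in (0 : ℝ)..x, |q t|)).const_mul B
  rw [mul_zero] at hlim
  exact norm_le_zero_iff.1 (ge_of_tendsto' hlim fun n => key n x hx)

end AbsolutelyContinuous

/-! ### Integrals over light cones. -/

section Cone

variable {α : Type*} [MeasurableSpace α] {ν : Measure α} {σ τ : α → ℝ} {h : α → ℂ}

/-- Half the integral of `h` over the points `a` whose forward light cone with apex `(σ a, τ a)`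
contains `(x, y)`. -/
noncomputable def coneIntegral (ν : Measure α) (σ τ : α → ℝ) (h : α → ℂ) (x y : ℝ) : ℂ :=
  1 / 2 * ∫ a, {a | |y - τ a| ≤ x - σ a}.indicator h a ∂ν

/-- Half the integral of `g` over the interval of radius `r` around `η`. -/
noncomputable def halfIntegral (g : ℝ → ℂ) (r η : ℝ) : ℂ := 1 / 2 * ∫ t in (η - r)..(η + r), g t

theorem stronglyMeasurable_cone_indicator (hσ : Measurable σ) (hτ : Measurable τ)
    (hh : StronglyMeasurable h) :
    StronglyMeasurable fun z : (ℝ × ℝ) × α =>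
      {a | |z.1.2 - τ a| ≤ z.1.1 - σ a}.indicator h z.2 := by
  have hs : MeasurableSet {z : (ℝ × ℝ) × α | |z.1.2 - τ z.2| ≤ z.1.1 - σ z.2} :=
    measurableSet_le (by fun_prop) (by fun_prop)
  exact (hh.comp_measurable measurable_snd).indicator hs

theorem stronglyMeasurable_coneIntegral [SFinite ν] (hσ : Measurable σ) (hτ : Measurable τ)
    (hh : StronglyMeasurable h) :
    StronglyMeasurable fun z : ℝ × ℝ => coneIntegral ν σ τ h z.1 z.2 :=
  (stronglyMeasurable_cone_indicator hσ hτ hh).integral_prod_right'.const_mul _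

theorem norm_coneIntegral_le {g : α → ℝ} (hg : Integrable g ν) (hg0 : ∀ a, 0 ≤ g a) {x y : ℝ}
    (hle : ∀ a, |y - τ a| ≤ x - σ a → ‖h a‖ ≤ g a) :
    ‖coneIntegral ν σ τ h x y‖ ≤ 1 / 2 * ∫ a, g a ∂ν := by
  rw [coneIntegral, norm_mul]
  refine mul_le_mul (by simp) (norm_integral_le_of_norm_le hg ?_) (norm_nonneg _) (by norm_num)
  refine Eventually.of_forall fun a => ?_
  by_cases ha : |y - τ a| ≤ x - σ a
  · rw [indicator_of_mem (by exact ha)]; exact hle a ha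
  · rw [indicator_of_notMem (by exact ha), norm_zero]; exact hg0 a

/-- Finite propagation speed: a cone with apex in `|τ| ≤ σ` stays inside `|y| ≤ x`, by the triangle
inequality. -/
theorem coneIntegral_eq_zero (hsupp : ∀ a, h a ≠ 0 → |τ a| ≤ σ a) {x y : ℝ} (hxy : ¬ |y| ≤ x) :
    coneIntegral ν σ τ h x y = 0 := by
  have : ∀ a, {a | |y - τ a| ≤ x - σ a}.indicator h a = 0 := by
    intro a
    by_contra hne
    have h1 := indicator_apply_ne_zero.1 hne
    have h2 := hsupp a h1.2
    have h3 : |y - τ a| ≤ x - σ a := h1.1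
    have h4 := abs_sub_abs_le_abs_sub y (τ a)
    exact hxy (by linarith)
  simp [coneIntegral, this]

theorem hasSum_coneIntegral {h' : ℕ → α → ℂ} {g : α → ℝ} {b : ℕ → ℝ} (hσ : Measurable σ)
    (hτ : Measurable τ) (hm : ∀ n, StronglyMeasurable (h' n)) (hg : Integrable g ν)
    (hb : Summable b) (hle : ∀ n a, ‖h' n a‖ ≤ g a * b n)
    (hs : ∀ a, HasSum (fun n => h' n a) (h a)) (x y : ℝ) :
    HasSum (fun n => coneIntegral ν σ τ (h' n) x y) (coneIntegral ν σ τ h x y) := by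
  have hset : MeasurableSet {a | |y - τ a| ≤ x - σ a} :=
    measurableSet_le (by fun_prop) (by fun_prop)
  refine HasSum.mul_left _ (hasSum_integral_of_dominated_convergence (fun n a => g a * b n)
    (fun n => ((hm n).indicator hset).aestronglyMeasurable) (fun n => ?_) ?_ ?_ ?_)
  · exact Eventually.of_forall fun a => (norm_indicator_le_norm_self _ _).trans (hle n a)
  · exact Eventually.of_forall fun a => hb.mul_left _
  · simp only [tsum_mul_left]; exact hg.mul_const _
  · refine Eventually.of_forall fun a => ?_
    by_cases ha : |y - τ a| ≤ x - σ a
    · simpa only [indicator_of_mem (show a ∈ {a | |y - τ a| ≤ x - σ a} from ha)] using hs a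
    · simpa only [indicator_of_notMem (show a ∉ {a | |y - τ a| ≤ x - σ a} from ha)] using hasSum_zero

/-- For a fixed apex the admissible `y` fill the interval of radius `x - σ a` around `τ a`. The
factor `2` undoes the `1 / 2` in `halfIntegral`. -/
theorem integral_cone_indicator_mul {α : Type*} {σ τ : α → ℝ} {h : α → ℂ} (g : ℝ → ℂ) (x : ℝ) (a : α) :
    ∫ y, {a | |y - τ a| ≤ x - σ a}.indicator h a * g y
      = 2 * {a | σ a ≤ x}.indicator (fun a => h a * halfIntegral g (x - σ a) (τ a)) a := by
  by_cases hx : σ a ≤ x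
  · rw [indicator_of_mem (show a ∈ {a | σ a ≤ x} from hx), halfIntegral,
      intervalIntegral.integral_of_le (by linarith), ← integral_Icc_eq_integral_Ioc,
      ← integral_indicator measurableSet_Icc]
    have : ∀ y, {a | |y - τ a| ≤ x - σ a}.indicator h a * g y
        = h a * (Icc (τ a - (x - σ a)) (τ a + (x - σ a))).indicator g y := by
      intro y
      by_cases hy : |y - τ a| ≤ x - σ a
      · have hy' := abs_le.1 hy
        rw [indicator_of_mem (by exact hy),
          indicator_of_mem (by constructor <;> linarith)]
      · rw [indicator_of_notMem (by exact hy), indicator_of_notMem, zero_mul, mul_zero]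
        rintro ⟨h1, h2⟩
        exact hy (abs_le.2 ⟨by linarith, by linarith⟩)
    simp_rw [this, integral_const_mul]
    ring
  · have : ∀ y, {a | |y - τ a| ≤ x - σ a}.indicator h a * g y = 0 := by
      intro y
      rw [indicator_of_notMem, zero_mul]
      intro hy
      have hy' : |y - τ a| ≤ x - σ a := hy
      linarith [abs_nonneg (y - τ a)]
    simp_rw [this]
    rw [indicator_of_notMem (by exact hx)]
    simp

/-- Fubini. The support condition confines `y` to `[-x, x]`, where `g` is bounded, and this provides
an integrable majorant on the product. -/
theorem integral_coneIntegral_mul [SFinite ν] (hσ : Measurable σ) (hτ : Measurable τ)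
    (hh : StronglyMeasurable h) (hi : Integrable h ν) (hsupp : ∀ a, h a ≠ 0 → |τ a| ≤ σ a)
    {g : ℝ → ℂ} (hg : Continuous g) (x : ℝ) :
    Integrable ({a | σ a ≤ x}.indicator fun a => h a * halfIntegral g (x - σ a) (τ a)) ν ∧
    Integrable (fun y => coneIntegral ν σ τ h x y * g y) ∧
    ∫ y, coneIntegral ν σ τ h x y * g y
      = ∫ a, {a | σ a ≤ x}.indicator (fun a => h a * halfIntegral g (x - σ a) (τ a)) a ∂ν := by
  obtain ⟨M, hM⟩ := (isCompact_Icc (a := -x) (b := x)).exists_bound_of_continuousOn hg.continuousOn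
  have hint : Integrable (fun z : ℝ × α =>
      {a | |z.1 - τ a| ≤ x - σ a}.indicator h z.2 * g z.1) (volume.prod ν) := by
    have hd : Integrable (fun z : ℝ × α => (Icc (-x) x).indicator (fun _ => M) z.1 * ‖h z.2‖)
        (volume.prod ν) := by
      refine Integrable.mul_prod ?_ hi.norm
      exact (integrable_indicator_iff measurableSet_Icc).2 (by simp)
    refine hd.mono' ?_ (Eventually.of_forall fun z => ?_)
    · have h1 := (stronglyMeasurable_cone_indicator hσ hτ hh).comp_measurable
        (show Measurable fun z : ℝ × α => ((x, z.1), z.2) by fun_prop)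
      exact (h1.mul (hg.stronglyMeasurable.comp_measurable measurable_fst)).aestronglyMeasurable
    · by_cases hz : z.2 ∈ {a | |z.1 - τ a| ≤ x - σ a} ∧ h z.2 ≠ 0
      · have h2 := hsupp _ hz.2
        have h3 : |z.1 - τ z.2| ≤ x - σ z.2 := hz.1
        have h4 := abs_sub_abs_le_abs_sub z.1 (τ z.2)
        have h5 : z.1 ∈ Icc (-x) x := abs_le.1 (by linarith)
        rw [indicator_of_mem hz.1, indicator_of_mem h5, norm_mul, mul_comm]
        gcongr
        exact hM _ h5
      · have : {a | |z.1 - τ a| ≤ x - σ a}.indicator h z.2 = 0 := by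
          rw [indicator_apply_eq_zero]
          intro h6
          by_contra h7
          exact hz ⟨h6, h7⟩
        rw [this, zero_mul, norm_zero]
        refine mul_nonneg ?_ (norm_nonneg _)
        refine indicator_nonneg (fun y hy => (norm_nonneg _).trans (hM y hy)) _
  have h1 := hint.integral_prod_right
  have h2 := hint.integral_prod_left
  have h3 := integral_integral_swap
    (f := fun y a => {a | |y - τ a| ≤ x - σ a}.indicator h a * g y) hint
  simp only [integral_cone_indicator_mul] at h1 h3
  refine ⟨?_, ?_, ?_⟩
  · refine (h1.const_mul (1 / 2 : ℂ)).congr (Eventually.of_forall fun a => ?_)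
    simp
  · refine (h2.const_mul (1 / 2 : ℂ)).congr (Eventually.of_forall fun y => ?_)
    simp only [integral_mul_const, coneIntegral]
    ring
  · rw [integral_const_mul] at h3
    simp only [coneIntegral, mul_assoc, integral_const_mul, integral_mul_const] at h3 ⊢
    rw [h3]
    ring

end Cone

/-! ### The transmutation kernel and its Neumann series. -/

/-- A measurable integrable potential on `ℝ` vanishing outside `(0, d)`. -/
structure IsPotential (d : ℝ) (q : ℝ → ℝ) : Prop where
  measurable : Measurable q
  integrable : Integrable q
  eq_zero : ∀ s, s ∉ Ioo 0 d → q s = 0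

/-- The terms of the Neumann series of the transmutation kernel. -/
noncomputable def kernelTerm (q : ℝ → ℝ) : ℕ → ℝ → ℝ → ℂ
  | 0 => coneIntegral volume id id fun s => (q s : ℂ)
  | n + 1 => coneIntegral volume Prod.fst Prod.snd fun p : ℝ × ℝ =>
      (q p.1 : ℂ) * kernelTerm q n p.1 p.2

/-- The transmutation kernel as the sum of its Neumann series. -/
noncomputable def kernel (q : ℝ → ℝ) (x y : ℝ) : ℂ := ∑' n, kernelTerm q n x y

variable {d : ℝ} {q : ℝ → ℝ}

theorem kernelTerm_eq_zero (hq : IsPotential d q) (n : ℕ) {x y : ℝ} (h : ¬ |y| ≤ x) :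
    kernelTerm q n x y = 0 := by
  induction n generalizing x y with
  | zero =>
    refine coneIntegral_eq_zero (fun s hs => ?_) h
    have : s ∈ Ioo 0 d := by
      by_contra hc
      exact hs (by simp [hq.eq_zero s hc])
    exact (abs_of_pos this.1).le
  | succ n ih =>
    refine coneIntegral_eq_zero (fun p hp => ?_) h
    by_contra hc
    exact hp (by rw [ih hc, mul_zero])

theorem stronglyMeasurable_kernelTerm (hq : IsPotential d q) (n : ℕ) :
    StronglyMeasurable fun z : ℝ × ℝ => kernelTerm q n z.1 z.2 := by
  have hqm : Measurable fun s => (q s : ℂ) := Complex.measurable_ofReal.comp hq.measurable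
  induction n with
  | zero =>
    exact stronglyMeasurable_coneIntegral measurable_id measurable_id hqm.stronglyMeasurable
  | succ n ih =>
    exact stronglyMeasurable_coneIntegral measurable_fst measurable_snd
      ((hqm.comp measurable_fst).stronglyMeasurable.mul ih)

/-- In each step the integral over the second variable costs at most `2 d`, whose `2` is absorbed by
the `1 / 2` of the cone integral; the integral over the first gains the factorial by
`integral_abs_mul_pow`. -/
theorem norm_kernelTerm_le (hd : 0 ≤ d) (hq : IsPotential d q) (n : ℕ) {x : ℝ} (hx : 0 ≤ x)
    (y : ℝ) : ‖kernelTerm q n x y‖ ≤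
      1 / 2 * (d ^ n * (∫ t in (0 : ℝ)..x, |q t|) ^ (n + 1) / (n + 1).factorial) := by
  have hpos : ∀ {x y s p : ℝ}, |y - p| ≤ x - s → s ≤ x := fun {x y s p} h => by
    linarith [abs_nonneg (y - p)]
  induction n generalizing x y with
  | zero =>
    have hi : Integrable ((Ioc 0 x).indicator fun s => |q s|) :=
      hq.integrable.abs.indicator measurableSet_Ioc
    refine (norm_coneIntegral_le hi (fun s => indicator_nonneg (fun _ _ => abs_nonneg _) _)
      fun s hs => ?_).trans (le_of_eq ?_)
    · by_cases h0 : s ∈ Ioo 0 d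
      · rw [indicator_of_mem (show s ∈ Ioc 0 x from ⟨h0.1, hpos hs⟩)]
        simp
      · rw [hq.eq_zero s h0]
        simp only [Complex.ofReal_zero, norm_zero]
        exact indicator_nonneg (fun _ _ => abs_nonneg _) _
    · rw [integral_indicator measurableSet_Ioc, ← intervalIntegral.integral_of_le hx]
      simp
  | succ n ih =>
    set Q : ℝ → ℝ := fun s => ∫ t in (0 : ℝ)..s, |q t| with hQ
    have hQ0 : ∀ s, 0 ≤ s → 0 ≤ Q s := fun s hs =>
      intervalIntegral.integral_nonneg hs fun _ _ => abs_nonneg _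
    set c : ℝ := 1 / 2 * (d ^ n / (n + 1).factorial) with hc
    have hc0 : 0 ≤ c := by positivity
    have hqi : IntervalIntegrable q volume 0 x := hq.integrable.intervalIntegrable
    have hi1 : IntervalIntegrable (fun s => c * (|q s| * Q s ^ (n + 1))) volume 0 x :=
      (hqi.abs.mul_continuousOn
        ((HasACDeriv.integral hx hqi.abs).ac.continuousOn.pow _)).const_mul _
    have hi2 : Integrable ((Ioc 0 x).indicator fun s => c * (|q s| * Q s ^ (n + 1))) :=
      (integrable_indicator_iff measurableSet_Ioc).2 ((intervalIntegrable_iff_integrableOn_Ioc_of_le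
        hx).1 hi1)
    have hi3 : Integrable ((Icc (-d) d).indicator fun _ => (1 : ℝ)) :=
      (integrable_indicator_iff measurableSet_Icc).2 (by simp)
    have hn2 : ∀ s, 0 ≤ (Ioc 0 x).indicator (fun s => c * (|q s| * Q s ^ (n + 1))) s := fun s =>
      indicator_nonneg (fun s hs => by
        have := hQ0 s hs.1.le
        positivity) _
    have hn3 : ∀ s, 0 ≤ (Icc (-d) d).indicator (fun _ => (1 : ℝ)) s := fun s =>
      indicator_nonneg (fun _ _ => zero_le_one) _
    refine (norm_coneIntegral_le (hi2.mul_prod hi3) (fun p => mul_nonneg (hn2 _) (hn3 _))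
      fun p hs => ?_).trans (le_of_eq ?_)
    · by_cases h0 : p.1 ∈ Ioo 0 d ∧ |p.2| ≤ p.1
      · rw [indicator_of_mem (show p.1 ∈ Ioc 0 x from ⟨h0.1.1, hpos hs⟩),
          indicator_of_mem (show p.2 ∈ Icc (-d) d from abs_le.1 (h0.2.trans h0.1.2.le)),
          mul_one, norm_mul, Complex.norm_real, Real.norm_eq_abs]
        have := ih h0.1.1.le p.2
        calc |q p.1| * ‖kernelTerm q n p.1 p.2‖ ≤ |q p.1| * _ :=
              mul_le_mul_of_nonneg_left this (abs_nonneg _)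
          _ = _ := by rw [hc, hQ]; ring
      · have : (q p.1 : ℂ) * kernelTerm q n p.1 p.2 = 0 := by
          by_cases h1 : p.1 ∈ Ioo 0 d
          · rw [kernelTerm_eq_zero hq n fun h2 => h0 ⟨h1, h2⟩, mul_zero]
          · simp [hq.eq_zero _ h1]
        rw [this, norm_zero]
        exact mul_nonneg (hn2 _) (hn3 _)
    · rw [integral_prod_mul, integral_indicator measurableSet_Ioc,
        ← intervalIntegral.integral_of_le hx, intervalIntegral.integral_const_mul,
        integral_abs_mul_pow hx hqi, integral_indicator measurableSet_Icc]
      simp only [integral_const, smul_eq_mul, mul_one, measureReal_restrict_apply, MeasurableSet.univ,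
        univ_inter, Real.volume_real_Icc_of_le (show -d ≤ d by linarith)]
      rw [hc, Nat.factorial_succ (n + 1)]
      push_cast
      field_simp
      ring

/-- A summable bound for the Neumann series. -/
noncomputable def kernelBound (d : ℝ) (q : ℝ → ℝ) (n : ℕ) : ℝ :=
  1 / 2 * (d ^ n * (∫ t, |q t|) ^ (n + 1) / (n + 1).factorial)

theorem kernelBound_nonneg (hd : 0 ≤ d) (n : ℕ) : 0 ≤ kernelBound d q n := by
  have : 0 ≤ ∫ t, |q t| := integral_nonneg fun _ => abs_nonneg _
  unfold kernelBound
  positivity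

theorem summable_kernelBound (hd : 0 ≤ d) : Summable (kernelBound d q) := by
  have hQ : 0 ≤ ∫ t, |q t| := integral_nonneg fun _ => abs_nonneg _
  refine Summable.of_nonneg_of_le (kernelBound_nonneg hd) (fun n => ?_)
    ((Real.summable_pow_div_factorial (d * ∫ t, |q t|)).mul_left (∫ t, |q t|))
  have h1 : d ^ n * (∫ t, |q t|) ^ (n + 1) / (n + 1).factorial
      ≤ d ^ n * (∫ t, |q t|) ^ (n + 1) / n.factorial := by
    gcongr
    exact Nat.le_succ n
  have h2 : 0 ≤ d ^ n * (∫ t, |q t|) ^ (n + 1) / (n + 1).factorial := by positivity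
  calc kernelBound d q n ≤ d ^ n * (∫ t, |q t|) ^ (n + 1) / n.factorial := by
        unfold kernelBound; linarith
    _ = _ := by rw [mul_pow]; ring

theorem norm_kernelTerm_le_kernelBound (hd : 0 ≤ d) (hq : IsPotential d q) (n : ℕ) (x y : ℝ) :
    ‖kernelTerm q n x y‖ ≤ kernelBound d q n := by
  by_cases hxy : |y| ≤ x
  · have hx : 0 ≤ x := (abs_nonneg y).trans hxy
    refine (norm_kernelTerm_le hd hq n hx y).trans ?_
    unfold kernelBound
    have h0 : 0 ≤ ∫ t in (0 : ℝ)..x, |q t| :=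
      intervalIntegral.integral_nonneg hx fun _ _ => abs_nonneg _
    have h1 : ∫ t in (0 : ℝ)..x, |q t| ≤ ∫ t, |q t| := by
      rw [intervalIntegral.integral_of_le hx]
      exact setIntegral_le_integral hq.integrable.abs (Eventually.of_forall fun _ => abs_nonneg _)
    gcongr
  · rw [kernelTerm_eq_zero hq n hxy, norm_zero]
    exact kernelBound_nonneg hd n

theorem hasSum_kernel (hd : 0 ≤ d) (hq : IsPotential d q) (x y : ℝ) :
    HasSum (fun n => kernelTerm q n x y) (kernel q x y) :=
  (Summable.of_norm_bounded (summable_kernelBound hd)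
    fun n => norm_kernelTerm_le_kernelBound hd hq n x y).hasSum

theorem kernel_eq_zero (hq : IsPotential d q) {x y : ℝ} (h : ¬ |y| ≤ x) : kernel q x y = 0 := by
  simp [kernel, kernelTerm_eq_zero hq _ h]

theorem norm_kernel_le (hd : 0 ≤ d) (hq : IsPotential d q) (x y : ℝ) :
    ‖kernel q x y‖ ≤ ∑' n, kernelBound d q n :=
  tsum_of_norm_bounded (summable_kernelBound hd).hasSum
    fun n => norm_kernelTerm_le_kernelBound hd hq n x y

theorem stronglyMeasurable_kernel (hd : 0 ≤ d) (hq : IsPotential d q) :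
    StronglyMeasurable fun z : ℝ × ℝ => kernel q z.1 z.2 := by
  refine stronglyMeasurable_of_tendsto atTop
    (f := fun (N : ℕ) (z : ℝ × ℝ) => ∑ n ∈ Finset.range N, kernelTerm q n z.1 z.2)
    (fun N => ?_) ?_
  · exact Finset.stronglyMeasurable_fun_sum _ fun n _ => stronglyMeasurable_kernelTerm hq n
  · exact tendsto_pi_nhds.2 fun z => (hasSum_kernel hd hq z.1 z.2).tendsto_sum_nat

/-- A common majorant for the Neumann terms and their sum: `q` vanishes off `(0, d)`, and there the
cone support puts the second variable in `[-d, d]`. -/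
theorem norm_mul_le_of_cone (hq : IsPotential d q) {K : ℝ → ℝ → ℂ} {B : ℝ}
    (h0 : ∀ x y, ¬ |y| ≤ x → K x y = 0) (hB : ∀ x y, ‖K x y‖ ≤ B) (p : ℝ × ℝ) :
    ‖(q p.1 : ℂ) * K p.1 p.2‖ ≤ |q p.1| * (Icc (-d) d).indicator (fun _ => (1 : ℝ)) p.2 * B := by
  by_cases hp : p.1 ∈ Ioo 0 d ∧ |p.2| ≤ p.1
  · rw [indicator_of_mem (show p.2 ∈ Icc (-d) d from abs_le.1 (hp.2.trans hp.1.2.le)), mul_one,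
      norm_mul, Complex.norm_real, Real.norm_eq_abs]
    gcongr
    exact hB _ _
  · have : (q p.1 : ℂ) * K p.1 p.2 = 0 := by
      by_cases h1 : p.1 ∈ Ioo 0 d
      · rw [h0 _ _ fun h2 => hp ⟨h1, h2⟩, mul_zero]
      · simp [hq.eq_zero _ h1]
    rw [this, norm_zero]
    exact mul_nonneg (mul_nonneg (abs_nonneg _) (indicator_nonneg (fun _ _ => zero_le_one) _))
      ((norm_nonneg _).trans (hB 0 0))

theorem integrable_abs_mul_indicator (hq : IsPotential d q) :
    Integrable (fun p : ℝ × ℝ => |q p.1| * (Icc (-d) d).indicator (fun _ => (1 : ℝ)) p.2) :=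
  hq.integrable.abs.mul_prod ((integrable_indicator_iff measurableSet_Icc).2 (by simp))

/-- The recursion for the terms is summed under the integral by dominated convergence; the term of
index `0` is the integral over the diagonal. -/
theorem kernel_eq (hd : 0 ≤ d) (hq : IsPotential d q) (x y : ℝ) :
    kernel q x y = coneIntegral volume id id (fun s => (q s : ℂ)) x y
      + coneIntegral volume Prod.fst Prod.snd
        (fun p : ℝ × ℝ => (q p.1 : ℂ) * kernel q p.1 p.2) x y := by
  have hqm : Measurable fun s => (q s : ℂ) := Complex.measurable_ofReal.comp hq.measurable
  have h1 := hasSum_coneIntegral (ν := volume) (σ := Prod.fst) (τ := Prod.snd)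
    (h := fun p : ℝ × ℝ => (q p.1 : ℂ) * kernel q p.1 p.2)
    (h' := fun n p => (q p.1 : ℂ) * kernelTerm q n p.1 p.2) measurable_fst measurable_snd
    (fun n => (hqm.comp measurable_fst).stronglyMeasurable.mul (stronglyMeasurable_kernelTerm hq n))
    (integrable_abs_mul_indicator hq) (summable_kernelBound hd)
    (fun n p => norm_mul_le_of_cone hq (fun x y h => kernelTerm_eq_zero hq n h)
      (norm_kernelTerm_le_kernelBound hd hq n) p)
    (fun p => (hasSum_kernel hd hq _ _).mul_left _) x y
  have h2 : HasSum (fun n => kernelTerm q (n + 1) x y) _ := h1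
  rw [(hasSum_kernel hd hq x y).unique ((hasSum_nat_add_iff 1).1 h2), Finset.sum_range_one, add_comm]
  rfl

theorem integrable_kernel_mul (hd : 0 ≤ d) (hq : IsPotential d q) {g : ℝ → ℂ} (hg : Continuous g)
    (x : ℝ) : Integrable fun y => kernel q x y * g y := by
  obtain ⟨M, hM⟩ := (isCompact_Icc (a := -x) (b := x)).exists_bound_of_continuousOn hg.continuousOn
  have hi : Integrable ((Icc (-x) x).indicator fun _ => (∑' n, kernelBound d q n) * M) :=
    (integrable_indicator_iff measurableSet_Icc).2 (integrableOn_const (by simp))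
  have hm : StronglyMeasurable fun y => kernel q x y :=
    (stronglyMeasurable_kernel hd hq).comp_measurable (show Measurable fun y => (x, y) by fun_prop)
  refine hi.mono' (hm.mul hg.stronglyMeasurable).aestronglyMeasurable
    (Eventually.of_forall fun y => ?_)
  by_cases hy : |y| ≤ x
  · have hy' := abs_le.1 hy
    rw [indicator_of_mem (by exact hy'), norm_mul]
    exact mul_le_mul (norm_kernel_le hd hq x y) (hM y hy') (norm_nonneg _)
      (tsum_nonneg (kernelBound_nonneg hd))
  · rw [kernel_eq_zero hq hy, zero_mul, norm_zero, indicator_of_notMem]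
    exact fun h => hy (abs_le.2 h)

/-- The Volterra equation satisfied by the integrals of a continuous function against the
transmutation kernel. -/
theorem integral_kernel_mul (hd : 0 ≤ d) (hq : IsPotential d q) {g : ℝ → ℂ} (hg : Continuous g)
    {x : ℝ} (hx : 0 ≤ x) :
    ∫ y, kernel q x y * g y = ∫ s in (0 : ℝ)..x, (q s : ℂ) *
      (halfIntegral g (x - s) s + ∫ y, kernel q s y * halfIntegral g (x - s) y) := by
  have hqm : Measurable fun s => (q s : ℂ) := Complex.measurable_ofReal.comp hq.measurable
  obtain ⟨a1, a2, a3⟩ := integral_coneIntegral_mul (ν := volume) (σ := id) (τ := id)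
    (h := fun s => (q s : ℂ)) measurable_id measurable_id hqm.stronglyMeasurable
    hq.integrable.ofReal (fun s hs => by
      have : s ∈ Ioo 0 d := by
        by_contra hc
        exact hs (by simp [hq.eq_zero s hc])
      exact (abs_of_pos this.1).le) hg x
  have hKm : StronglyMeasurable fun p : ℝ × ℝ => (q p.1 : ℂ) * kernel q p.1 p.2 :=
    (hqm.comp measurable_fst).stronglyMeasurable.mul (stronglyMeasurable_kernel hd hq)
  obtain ⟨b1, b2, b3⟩ := integral_coneIntegral_mul (ν := volume) (σ := Prod.fst) (τ := Prod.snd)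
    (h := fun p : ℝ × ℝ => (q p.1 : ℂ) * kernel q p.1 p.2) measurable_fst measurable_snd hKm
    (((integrable_abs_mul_indicator hq).mul_const (∑' n, kernelBound d q n)).mono'
      hKm.aestronglyMeasurable (Eventually.of_forall
      (norm_mul_le_of_cone hq (fun x y h => kernel_eq_zero hq h) (norm_kernel_le hd hq))))
    (fun p hp => by
      by_contra hc
      exact hp (by rw [kernel_eq_zero hq hc, mul_zero])) hg x
  rw [show (fun y => kernel q x y * g y) = fun y => _ from funext fun y => by rw [kernel_eq hd hq x y, add_mul]]
  rw [integral_add a2 b2, a3, b3, Measure.volume_eq_prod, integral_prod _ b1,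
    ← integral_add a1 b1.integral_prod_left, intervalIntegral.integral_of_le hx,
    ← integral_indicator measurableSet_Ioc]
  congr 1
  ext s
  by_cases hs : s ∈ Ioc 0 x
  · rw [indicator_of_mem hs, indicator_of_mem (by exact hs.2)]
    have : ∀ y, {a : ℝ × ℝ | a.1 ≤ x}.indicator (fun a => (q a.1 : ℂ) * kernel q a.1 a.2 *
        halfIntegral g (x - a.1) a.2) (s, y)
        = (q s : ℂ) * (kernel q s y * halfIntegral g (x - s) y) := fun y => by
      rw [indicator_of_mem (by exact hs.2), mul_assoc]
    simp_rw [this, integral_const_mul, mul_add, id]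
  -- Outside `(0, x]` either the cone condition fails (`s > x`) or `q s = 0` (`s ≤ 0`).
  · rw [indicator_of_notMem hs]
    by_cases h0 : 0 < s
    · have h2 : ¬ s ≤ x := fun h => hs ⟨h0, h⟩
      have : ∀ y, {a : ℝ × ℝ | a.1 ≤ x}.indicator (fun a => (q a.1 : ℂ) * kernel q a.1 a.2 *
          halfIntegral g (x - a.1) a.2) (s, y) = 0 := fun y =>
        indicator_of_notMem (by exact h2) _
      simp_rw [this]
      rw [indicator_of_notMem (by exact h2)]
      simp
    · have hq0 : q s = 0 := hq.eq_zero s fun h => h0 h.1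
      simp [indicator_apply, hq0]

/-! ### Uniqueness for Volterra equations. -/

section Volterra

/-- Bounded and measurable on `[0, d]`. -/
structure BoundedMeasurable (d : ℝ) (X : ℝ → ℂ) : Prop where
  meas : AEStronglyMeasurable X (volume.restrict (Icc 0 d))
  bound : ∃ B, ∀ x ∈ Icc 0 d, ‖X x‖ ≤ B

theorem BoundedMeasurable.of_continuousOn {X : ℝ → ℂ} (h : ContinuousOn X (Icc 0 d)) :
    BoundedMeasurable d X :=
  ⟨h.aestronglyMeasurable measurableSet_Icc, isCompact_Icc.exists_bound_of_continuousOn h⟩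

theorem BoundedMeasurable.add {X Y : ℝ → ℂ} (hX : BoundedMeasurable d X)
    (hY : BoundedMeasurable d Y) : BoundedMeasurable d fun x => X x + Y x := by
  obtain ⟨A, hA⟩ := hX.bound
  obtain ⟨B, hB⟩ := hY.bound
  exact ⟨hX.meas.add hY.meas, A + B, fun x hx => norm_add_le_of_le (hA x hx) (hB x hx)⟩

theorem BoundedMeasurable.intervalIntegrable {X k : ℝ → ℂ} (hX : BoundedMeasurable d X)
    (hq : Integrable q) (hk : Continuous k) {x : ℝ} (hx : x ∈ Icc 0 d) :
    IntervalIntegrable (fun s => (q s : ℂ) * (k s * X s)) volume 0 x := by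
  obtain ⟨B, hB⟩ := hX.bound
  have hsub : Ioc 0 x ⊆ Icc 0 d := fun s hs => ⟨hs.1.le, hs.2.trans hx.2⟩
  have h1 : IntervalIntegrable (fun s => (q s : ℂ) * X s) volume 0 x := by
    rw [intervalIntegrable_iff_integrableOn_Ioc_of_le hx.1]
    refine Integrable.mul_bdd (c := B) hq.ofReal.integrableOn
      (hX.meas.mono_measure (Measure.restrict_mono hsub le_rfl)) ?_
    filter_upwards [ae_restrict_mem measurableSet_Ioc] with s hs using hB s (hsub hs)
  refine (h1.continuousOn_mul hk.continuousOn).congr fun s _ => ?_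
  ring

/-- Uniqueness for triangular systems of Volterra equations. -/
theorem volterra_unique (hd : 0 ≤ d) (hq : Integrable q) {κ : ℕ → ℝ → ℂ}
    (hκ : ∀ m, Continuous (κ m)) {X Y h : ℕ → ℝ → ℂ}
    (hX : ∀ k, BoundedMeasurable d (X k)) (hY : ∀ k, BoundedMeasurable d (Y k))
    (eX : ∀ k, ∀ x ∈ Icc 0 d, X k x = h k x + ∫ s in (0 : ℝ)..x,
      (q s : ℂ) * ∑ p ∈ Finset.HasAntidiagonal.antidiagonal k, κ p.1 (x - s) * X p.2 s)
    (eY : ∀ k, ∀ x ∈ Icc 0 d, Y k x = h k x + ∫ s in (0 : ℝ)..x,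
      (q s : ℂ) * ∑ p ∈ Finset.HasAntidiagonal.antidiagonal k, κ p.1 (x - s) * Y p.2 s) :
    ∀ k, ∀ x ∈ Icc 0 d, X k x = Y k x := by
  intro k
  induction k using Nat.strong_induction_on with
  | _ k ih =>
    obtain ⟨A, hA⟩ := (hX k).bound
    obtain ⟨B, hB⟩ := (hY k).bound
    obtain ⟨C, hC⟩ := (isCompact_Icc (a := 0) (b := d)).exists_bound_of_continuousOn
      (hκ 0).continuousOn
    have hint : ∀ {Z : ℕ → ℝ → ℂ}, (∀ k, BoundedMeasurable d (Z k)) → ∀ x ∈ Icc 0 d,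
        IntervalIntegrable (fun s => (q s : ℂ) *
          ∑ p ∈ Finset.HasAntidiagonal.antidiagonal k, κ p.1 (x - s) * Z p.2 s) volume 0 x := by
      intro Z hZ x hx
      simp only [Finset.mul_sum]
      have := IntervalIntegrable.sum (μ := volume) (a := 0) (b := x)
        (Finset.HasAntidiagonal.antidiagonal k) (f := fun (p : ℕ × ℕ) s =>
        (q s : ℂ) * (κ p.1 (x - s) * Z p.2 s)) fun p _ =>
          (hZ p.2).intervalIntegrable hq ((hκ p.1).comp (by fun_prop)) hx
      simpa only [Finset.sum_fn] using this
    have key := eq_zero_of_norm_le_integral hd (hq.intervalIntegrable)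
      (δ := fun x => X k x - Y k x) (k := fun x s => κ 0 (x - s)) (B := A + B) (C := C)
      (fun x hx => norm_sub_le_of_le (hA x hx) (hB x hx))
      (fun x hx s hs => hC _ ⟨by linarith [hs.2], by linarith [hs.1, hx.2]⟩) ?_
    · exact fun x hx => sub_eq_zero.1 (key x hx)
    · intro x hx
      rw [eX k x hx, eY k x hx, add_sub_add_left_eq_sub,
        ← intervalIntegral.integral_sub (hint hX x hx) (hint hY x hx)]
      refine intervalIntegral.integral_congr fun s hs => ?_
      rw [uIcc_of_le hx.1] at hs
      -- Terms with `m > 0` involve indices below `k`, where both families already agree. Only `(0,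
      -- k)` survives, leaving a scalar homogeneous equation for the difference.
      rw [← mul_sub, ← Finset.sum_sub_distrib, Finset.sum_eq_single (0, k)]
      · simp only; ring
      · rintro ⟨m, l⟩ hml hne
        have hml' := Finset.HasAntidiagonal.mem_antidiagonal.1 hml
        simp only at hml' ⊢
        have hl : l < k := by
          rcases Nat.eq_zero_or_pos m with rfl | hm
          · exact absurd (by simp [← hml']) hne
          · omega
        rw [ih l hl s ⟨hs.1, hs.2.trans hx.2⟩, sub_self]
      · intro hn; simp at hn

end Volterra

/-! ### Integrals of continuous functions against the kernel. -/

section KernelIntegral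

theorem boundedMeasurable_integral_kernel (hd : 0 ≤ d) (hq : IsPotential d q) {g : ℝ → ℂ}
    (hg : Continuous g) : BoundedMeasurable d fun x => ∫ y, kernel q x y * g y := by
  constructor
  · have h : StronglyMeasurable fun z : ℝ × ℝ => kernel q z.1 z.2 * g z.2 :=
      (stronglyMeasurable_kernel hd hq).mul (hg.stronglyMeasurable.comp_measurable measurable_snd)
    exact h.integral_prod_right'.aestronglyMeasurable
  · obtain ⟨M, hM⟩ := (isCompact_Icc (a := -d) (b := d)).exists_bound_of_continuousOn
      hg.continuousOn
    have hi : Integrable ((Icc (-d) d).indicator fun _ => (∑' n, kernelBound d q n) * M) :=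
      (integrable_indicator_iff measurableSet_Icc).2 (integrableOn_const (by simp))
    refine ⟨_, fun x hx => norm_integral_le_of_norm_le hi (Eventually.of_forall fun y => ?_)⟩
    have hS : 0 ≤ ∑' n, kernelBound d q n := tsum_nonneg (kernelBound_nonneg hd)
    by_cases hy : |y| ≤ x
    · have hy' : y ∈ Icc (-d) d := abs_le.1 (hy.trans hx.2)
      rw [indicator_of_mem hy', norm_mul]
      exact mul_le_mul (norm_kernel_le hd hq x y) (hM y hy') (norm_nonneg _) hS
    · rw [kernel_eq_zero hq hy, zero_mul, norm_zero]
      exact indicator_nonneg (fun y hy => mul_nonneg hS ((norm_nonneg _).trans (hM y hy))) _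

/-- As a primitive of the symmetric mean `(g(η + t) + g(η - t)) / 2`, the half integral is
accessible to addition theorems. -/
theorem halfIntegral_eq {g : ℝ → ℂ} (hg : Continuous g) (r η : ℝ) :
    halfIntegral g r η = ∫ t in (0 : ℝ)..r, (g (η + t) + g (η - t)) / 2 := by
  have h1 : IntervalIntegrable (fun t => g (η + t)) volume 0 r :=
    (hg.comp (by fun_prop)).intervalIntegrable _ _
  have h2 : IntervalIntegrable (fun t => g (η - t)) volume 0 r :=
    (hg.comp (by fun_prop)).intervalIntegrable _ _
  rw [intervalIntegral.integral_div, intervalIntegral.integral_add h1 h2,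
    intervalIntegral.integral_comp_add_left (fun t => g t) η,
    intervalIntegral.integral_comp_sub_left (fun t => g t) η, halfIntegral, add_comm (∫ _ in _.._, _),
    add_zero, sub_zero,
    intervalIntegral.integral_add_adjacent_intervals (hg.intervalIntegrable _ _)
      (hg.intervalIntegrable _ _)]
  ring

end KernelIntegral

/-! ### The solutions `u(ω, ·)` as images of exponentials. -/

section Exponential

/-- The solution `sin (ω r) / ω` of `y'' = -ω² y`, written so as to include `ω = 0`. -/
noncomputable def sineSolution (ω r : ℝ) : ℝ := ∫ t in (0 : ℝ)..r, Real.cos (ω * t)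

theorem hasDerivAt_sineSolution (ω r : ℝ) :
    HasDerivAt (sineSolution ω) (Real.cos (ω * r)) r := by
  have hc : Continuous fun t => Real.cos (ω * t) := by fun_prop
  exact intervalIntegral.integral_hasDerivAt_right (hc.intervalIntegrable _ _)
    (hc.stronglyMeasurableAtFilter _ _) hc.continuousAt

theorem continuous_sineSolution (ω : ℝ) : Continuous (sineSolution ω) :=
  continuous_iff_continuousAt.2 fun r => (hasDerivAt_sineSolution ω r).continuousAt

theorem mul_sineSolution (ω r : ℝ) : ω * sineSolution ω r = Real.sin (ω * r) := by
  rw [sineSolution, intervalIntegral.mul_integral_comp_mul_left]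
  simp

theorem exp_eq_cos_sub (z : ℂ) : Complex.exp (-Complex.I * z) =
    Complex.cos z - Complex.I * Complex.sin z := by
  rw [show -Complex.I * z = (-z) * Complex.I by ring, Complex.exp_mul_I, Complex.cos_neg,
    Complex.sin_neg]
  ring

/-- An exponential is an eigenfunction of the symmetric mean with eigenvalue `cos (ω t)`. -/
theorem halfIntegral_exp (ω r η : ℝ) :
    halfIntegral (fun y => Complex.exp (-Complex.I * ω * y)) r η
      = (sineSolution ω r : ℂ) * Complex.exp (-Complex.I * ω * η) := by
  rw [halfIntegral_eq (by fun_prop), sineSolution, ← intervalIntegral.integral_ofReal,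
    ← intervalIntegral.integral_mul_const]
  refine intervalIntegral.integral_congr fun t _ => ?_
  simp only [Complex.ofReal_add, Complex.ofReal_sub, mul_add, mul_sub, Complex.exp_add,
    Complex.exp_sub, Complex.ofReal_cos, Complex.ofReal_mul, Complex.cos]
  rw [show (ω * t * Complex.I : ℂ) = -(-Complex.I * ω * t) by ring,
    show (-(ω * t) * Complex.I : ℂ) = (-Complex.I * ω * t) by ring, Complex.exp_neg]
  ring

theorem SolvesIVP.exists_hasACDeriv {lam α β : ℂ} {u : ℝ → ℂ} (hd : 0 ≤ d) (hq : Integrable q)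
    (h : SolvesIVP q d lam α β u) : ∃ v, HasACDeriv d u v ∧
      HasACDeriv d v (fun x => (q x : ℂ) * u x - lam * u x) ∧ u 0 = α ∧ v 0 = β := by
  obtain ⟨v, h1, h2, h3, h4, h5⟩ := h
  have hv : ContinuousOn v (Icc 0 d) := by simpa [uIcc_of_le hd] using h2.continuousOn
  have hu : ContinuousOn u (uIcc 0 d) := by
    rw [uIcc_of_le hd]
    exact fun x hx => (h1 x hx).continuousWithinAt
  refine ⟨v, HasACDeriv.of_hasDerivWithinAt hd h1 hv, ⟨h2, ?_, ?_⟩, h4, h5⟩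
  · filter_upwards [h3] with x hx hx'
    obtain ⟨w, hw, he⟩ := hx hx'
    rwa [show (q x : ℂ) * u x - lam * u x = w by rw [← he]; ring]
  · exact (hq.ofReal.intervalIntegrable.mul_continuousOn hu).sub
      (hu.intervalIntegrable.const_mul _)

/-- Variation of constants: `cos (ω (x - s)) u(s) + S(x - s) u'(s)`, with `S = sineSolution ω`, has
`s`-derivative `q(s) S(x - s) u(s)`. It equals `u(x)` at `s = x` and the exponential at `s = 0`. -/
theorem SolvesIVP.eq_integral_sineSolution {ω : ℝ} {u : ℝ → ℂ} (hd : 0 ≤ d) (hq : Integrable q)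
    (h : SolvesIVP q d ((ω : ℂ) ^ 2) 1 (-Complex.I * ω) u) {x : ℝ} (hx : x ∈ Icc 0 d) :
    u x = Complex.exp (-Complex.I * ω * x)
      + ∫ s in (0 : ℝ)..x, (q s : ℂ) * ((sineSolution ω (x - s) : ℂ) * u s) := by
  obtain ⟨v, hu, hv, hu0, hv0⟩ := h.exists_hasACDeriv hd hq
  have hS : ∀ s, HasDerivAt (fun s => (sineSolution ω (x - s) : ℂ))
      (-(Real.cos (ω * (x - s)) : ℂ)) s := fun s => by
    have := ((hasDerivAt_sineSolution ω (x - s)).comp s ((hasDerivAt_id s).const_sub x)).ofReal_comp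
    simpa [Function.comp_def] using this
  have hC : ∀ s, HasDerivAt (fun s => (Real.cos (ω * (x - s)) : ℂ))
      ((ω : ℂ) ^ 2 * sineSolution ω (x - s)) s := fun s => by
    have h1 : HasDerivAt (fun s => ω * (x - s)) (-ω) s := by
      simpa using ((hasDerivAt_id s).const_sub x).const_mul ω
    have := h1.cos.ofReal_comp
    convert this using 1
    rw [← mul_sineSolution]
    push_cast; ring
  have hSa := HasACDeriv.of_hasDerivAt hx.1 hS (by fun_prop)
  have hCa := HasACDeriv.of_hasDerivAt hx.1 hC (continuous_const.mul
    (Complex.continuous_ofReal.comp ((continuous_sineSolution ω).comp (by fun_prop))))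
  have key := ((hCa.mul (hu.mono hx)).add (hSa.mul (hv.mono hx))).eq_integral hx.1
  simp only [sub_self, sub_zero, mul_zero, Real.cos_zero, hu0, hv0] at key
  rw [show sineSolution ω 0 = 0 by simp [sineSolution]] at key
  simp only [Complex.ofReal_one, Complex.ofReal_zero, one_mul, zero_mul, add_zero, mul_one] at key
  rw [key]
  congr 1
  · have := mul_sineSolution ω x
    rw [mul_assoc (-Complex.I), exp_eq_cos_sub, ← Complex.ofReal_mul, ← Complex.ofReal_cos,
      ← Complex.ofReal_sin, ← this]
    push_cast; ring
  · refine intervalIntegral.integral_congr fun s _ => ?_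
    ring

/-- The kernel represents the solutions `u(ω, ·)`. -/
theorem SolvesIVP.eq_exp_add_integral_kernel {ω : ℝ} {u : ℝ → ℂ} (hd : 0 ≤ d)
    (hq : IsPotential d q) (h : SolvesIVP q d ((ω : ℂ) ^ 2) 1 (-Complex.I * ω) u) {x : ℝ}
    (hx : x ∈ Icc 0 d) : u x = Complex.exp (-Complex.I * ω * x)
      + ∫ y, kernel q x y * Complex.exp (-Complex.I * ω * y) := by
  obtain ⟨v, hu, -⟩ := h.exists_hasACDeriv hd hq.integrable
  have hcE : Continuous fun y : ℝ => Complex.exp (-Complex.I * ω * y) := by fun_prop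
  -- The scalar equation is viewed as a constant family whose coefficients `κ m` vanish for `m ≠ 0`,
  -- so that `volterra_unique` applies.
  have hsum : ∀ (f : ℝ → ℂ) (k : ℕ) (x s : ℝ), ∑ p ∈ Finset.HasAntidiagonal.antidiagonal k,
      (fun (m : ℕ) (r : ℝ) => if m = 0 then (sineSolution ω r : ℂ) else 0) p.1 (x - s) * f s
      = (sineSolution ω (x - s) : ℂ) * f s := by
    intro f k x s
    rw [Finset.sum_eq_single (0, k)]
    · simp
    · rintro ⟨m, l⟩ hml hne
      have : m ≠ 0 := by
        rintro rfl
        exact hne (by simpa using hml)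
      simp [this]
    · intro hn; simp at hn
  refine volterra_unique hd hq.integrable
    (κ := fun m r => if m = 0 then (sineSolution ω r : ℂ) else 0) ?_
    (X := fun _ => u) (Y := fun _ x => Complex.exp (-Complex.I * ω * x)
      + ∫ y, kernel q x y * Complex.exp (-Complex.I * ω * y))
    (h := fun _ x => Complex.exp (-Complex.I * ω * x)) ?_ ?_ ?_ ?_ 0 x hx
  · intro m
    by_cases hm : m = 0
    · simpa [hm, Function.comp_def] using Complex.continuous_ofReal.comp (continuous_sineSolution ω)
    · simpa [hm] using continuous_const
  · exact fun _ => .of_continuousOn (hu.continuousOn hd)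
  · exact fun _ => (BoundedMeasurable.of_continuousOn hcE.continuousOn).add
      (boundedMeasurable_integral_kernel hd hq hcE)
  · intro k x hx
    simp only [hsum u]
    exact h.eq_integral_sineSolution hd hq.integrable hx
  · intro k x hx
    simp only [hsum (fun s => Complex.exp (-Complex.I * ω * s)
      + ∫ y, kernel q s y * Complex.exp (-Complex.I * ω * y))]
    congr 1
    rw [integral_kernel_mul hd hq hcE hx.1]
    refine intervalIntegral.integral_congr fun s _ => ?_
    simp only [halfIntegral_exp, mul_left_comm (kernel q s _), integral_const_mul, mul_add]

end Exponential

/-! ### Taylor coefficients in the spectral parameter as images of powers. -/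

/-- The shift of a sequence by two indices, filled up with zeros. -/
def shiftTwo {α : Type*} [Zero α] (p : ℕ → α) : ℕ → α
  | 0 => 0
  | 1 => 0
  | k + 2 => p k

/-- The functions `p k` are the Taylor coefficients at `λ = 0` of a solution: `p k'' = q p k + p (k - 2)`
with the initial data of `x ^ k / k!`, except that `p 0' 0 = c`. -/
structure IsTaylorFamily (d : ℝ) (q : ℝ → ℝ) (c : ℂ) (p p' : ℕ → ℝ → ℂ) : Prop where
  deriv : ∀ k, HasACDeriv d (p k) (p' k)
  deriv' : ∀ k, HasACDeriv d (p' k) fun s => (q s : ℂ) * p k s + shiftTwo p k s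
  zero : ∀ k, p k 0 = if k = 0 then 1 else 0
  zero' : ∀ k, p' k 0 = if k = 0 then c else if k = 1 then 1 else 0

/-- The Taylor coefficients of the hyperbolic cosine. -/
noncomputable def coshTerm (m : ℕ) (r : ℝ) : ℂ := ((r : ℂ) ^ m + (-r) ^ m) / (2 * m.factorial)

/-- The primitives of `coshTerm`. -/
noncomputable def sinhTerm (m : ℕ) (r : ℝ) : ℂ :=
  ((r : ℂ) ^ (m + 1) - (-r) ^ (m + 1)) / (2 * (m + 1).factorial)

theorem continuous_coshTerm (m : ℕ) : Continuous (coshTerm m) := by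
  unfold coshTerm; fun_prop

theorem continuous_sinhTerm (m : ℕ) : Continuous (sinhTerm m) := by
  unfold sinhTerm; fun_prop

theorem hasDerivAt_pow_ofReal (m : ℕ) (r : ℝ) :
    HasDerivAt (fun r : ℝ => (r : ℂ) ^ (m + 1)) ((m + 1) * (r : ℂ) ^ m) r := by
  simpa using (hasDerivAt_pow (m + 1) (r : ℂ)).comp_ofReal

theorem hasDerivAt_neg_pow_ofReal (m : ℕ) (r : ℝ) :
    HasDerivAt (fun r : ℝ => (-r : ℂ) ^ (m + 1)) (-((m + 1) * (-r : ℂ) ^ m)) r := by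
  have h := ((hasDerivAt_id (r : ℂ)).neg.pow (m + 1)).comp_ofReal
  simpa using h

theorem hasDerivAt_sinhTerm (m : ℕ) (r : ℝ) : HasDerivAt (sinhTerm m) (coshTerm m r) r := by
  have h := ((hasDerivAt_pow_ofReal m r).sub (hasDerivAt_neg_pow_ofReal m r)).div_const
    (2 * (m + 1).factorial : ℂ)
  refine h.congr_deriv ?_
  have h1 : (m.factorial : ℂ) ≠ 0 := by exact_mod_cast m.factorial_ne_zero
  have h2 : (m + 1 : ℂ) ≠ 0 := by exact_mod_cast m.succ_ne_zero
  rw [coshTerm, Nat.factorial_succ]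
  push_cast
  field_simp
  ring

/-- `sinhTerm m` has index one below its degree, so differentiating degree `m` to degree `m - 1`
lowers the index by two. -/
theorem hasDerivAt_coshTerm (m : ℕ) (r : ℝ) :
    HasDerivAt (coshTerm m) (shiftTwo sinhTerm m r) r := by
  match m with
  | 0 =>
    have : coshTerm 0 = fun _ => 1 := by ext r; simp [coshTerm]
    rw [this]
    exact hasDerivAt_const r (1 : ℂ)
  | 1 =>
    have : coshTerm 1 = fun _ => 0 := by ext r; simp [coshTerm]
    rw [this]
    exact hasDerivAt_const r (0 : ℂ)
  | m + 2 =>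
    have h := ((hasDerivAt_pow_ofReal (m + 1) r).add (hasDerivAt_neg_pow_ofReal (m + 1) r)).div_const
      (2 * (m + 2).factorial : ℂ)
    refine h.congr_deriv ?_
    have h1 : ((m + 1).factorial : ℂ) ≠ 0 := by exact_mod_cast (m + 1).factorial_ne_zero
    have h2 : (m + 1 + 1 : ℂ) ≠ 0 := by exact_mod_cast (m + 1).succ_ne_zero
    rw [shiftTwo, sinhTerm, Nat.factorial_succ (m + 1)]
    push_cast
    field_simp
    ring

theorem add_pow_div_factorial (a b : ℂ) (k : ℕ) : (a + b) ^ k / k.factorial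
    = ∑ p ∈ Finset.HasAntidiagonal.antidiagonal k,
      a ^ p.1 / p.1.factorial * (b ^ p.2 / p.2.factorial) := by
  rw [Finset.Nat.sum_antidiagonal_eq_sum_range_succ
    (fun i j => a ^ i / i.factorial * (b ^ j / j.factorial)), add_pow, Finset.sum_div]
  refine Finset.sum_congr rfl fun i hi => ?_
  have hi' : i ≤ k := by simpa [Nat.lt_succ_iff] using hi
  have h1 : (k.factorial : ℂ) ≠ 0 := by exact_mod_cast k.factorial_ne_zero
  have h2 : (i.factorial : ℂ) ≠ 0 := by exact_mod_cast i.factorial_ne_zero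
  have h3 : ((k - i).factorial : ℂ) ≠ 0 := by exact_mod_cast (k - i).factorial_ne_zero
  have h4 : (k.choose i : ℂ) * i.factorial * (k - i).factorial = k.factorial := by
    exact_mod_cast Nat.choose_mul_factorial_mul_factorial hi'
  rw [← h4]
  have h5 : (k.choose i : ℂ) ≠ 0 := by exact_mod_cast (Nat.choose_pos hi').ne'
  field_simp

/-- By the binomial theorem the symmetric mean replaces powers of `t` by `coshTerm`, whose primitive
is `sinhTerm`. -/
theorem halfIntegral_pow (k : ℕ) (r η : ℝ) :
    halfIntegral (fun y => (y : ℂ) ^ k / k.factorial) r η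
      = ∑ p ∈ Finset.HasAntidiagonal.antidiagonal k,
        sinhTerm p.1 r * ((η : ℂ) ^ p.2 / p.2.factorial) := by
  rw [halfIntegral_eq (by fun_prop)]
  have h : ∀ t : ℝ, (((η + t : ℝ) : ℂ) ^ k / k.factorial
      + ((η - t : ℝ) : ℂ) ^ k / k.factorial) / 2
      = ∑ p ∈ Finset.HasAntidiagonal.antidiagonal k,
        coshTerm p.1 t * ((η : ℂ) ^ p.2 / p.2.factorial) := by
    intro t
    rw [Complex.ofReal_add, Complex.ofReal_sub, add_comm (η : ℂ), sub_eq_neg_add (η : ℂ),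
      add_pow_div_factorial, add_pow_div_factorial, ← Finset.sum_add_distrib, Finset.sum_div]
    refine Finset.sum_congr rfl fun p _ => ?_
    rw [coshTerm]
    have h2 : (p.1.factorial : ℂ) ≠ 0 := by exact_mod_cast p.1.factorial_ne_zero
    field_simp
  simp_rw [h]
  rw [intervalIntegral.integral_finsetSum fun p _ =>
    ((continuous_coshTerm p.1).mul continuous_const).intervalIntegrable _ _]
  refine Finset.sum_congr rfl fun p _ => ?_
  rw [intervalIntegral.integral_mul_const, intervalIntegral.integral_eq_sub_of_hasDerivAt
    (fun t _ => hasDerivAt_sinhTerm p.1 t) ((continuous_coshTerm p.1).intervalIntegrable _ _)]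
  simp [sinhTerm]

/-- In a Cauchy product, multiplication by the square of the formal variable may be moved from one
factor to the other. -/
theorem sum_shiftTwo_mul (a b : ℕ → ℂ) (k : ℕ) :
    ∑ p ∈ Finset.HasAntidiagonal.antidiagonal k, shiftTwo a p.1 * b p.2
      = ∑ p ∈ Finset.HasAntidiagonal.antidiagonal k, a p.1 * shiftTwo b p.2 := by
  match k with
  | 0 => simp [shiftTwo]
  | 1 => simp [Finset.Nat.antidiagonal_succ, shiftTwo]
  | k + 2 =>
    rw [Finset.Nat.sum_antidiagonal_succ, Finset.Nat.sum_antidiagonal_succ,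
      Finset.Nat.sum_antidiagonal_succ', Finset.Nat.sum_antidiagonal_succ']
    simp [shiftTwo]

theorem shiftTwo_apply {p : ℕ → ℝ → ℂ} (k : ℕ) (s : ℝ) :
    shiftTwo p k s = shiftTwo (fun k => p k s) k := by
  match k with
  | 0 => rfl
  | 1 => rfl
  | k + 2 => rfl

theorem continuous_shiftTwo_sinhTerm (k : ℕ) : Continuous (shiftTwo sinhTerm k) := by
  match k with
  | 0 => exact continuous_zero
  | 1 => exact continuous_zero
  | k + 2 => exact continuous_sinhTerm k

/-- Variation of constants read off coefficient by coefficient in `μ`, with `cosh (μ r)` and `sinh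
(μ r) / μ` in place of the trigonometric functions. -/
theorem IsTaylorFamily.eq_integral {p p' : ℕ → ℝ → ℂ} (h : IsTaylorFamily d q 0 p p') (k : ℕ) {x : ℝ}
    (hx : x ∈ Icc 0 d) : p k x = (x : ℂ) ^ k / k.factorial + ∫ s in (0 : ℝ)..x,
      (q s : ℂ) * ∑ i ∈ Finset.HasAntidiagonal.antidiagonal k, sinhTerm i.1 (x - s) * p i.2 s := by
  have hS : ∀ m, HasACDeriv x (fun s => sinhTerm m (x - s)) (fun s => -coshTerm m (x - s)) :=
    fun m => HasACDeriv.of_hasDerivAt hx.1 (fun s => by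
      simpa [Function.comp_def] using
        (hasDerivAt_sinhTerm m (x - s)).scomp s ((hasDerivAt_id s).const_sub x))
      ((continuous_coshTerm m).comp (by fun_prop)).neg
  have hC : ∀ m, HasACDeriv x (fun s => coshTerm m (x - s))
      (fun s => -shiftTwo sinhTerm m (x - s)) :=
    fun m => HasACDeriv.of_hasDerivAt hx.1 (fun s => by
      simpa [Function.comp_def] using
        (hasDerivAt_coshTerm m (x - s)).scomp s ((hasDerivAt_id s).const_sub x))
      ((continuous_shiftTwo_sinhTerm m).comp (by fun_prop)).neg
  have key := (HasACDeriv.sum (Finset.HasAntidiagonal.antidiagonal k)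
    (F := fun i s => coshTerm i.1 (x - s) * p i.2 s + sinhTerm i.1 (x - s) * p' i.2 s)
    fun i _ => ((hC i.1).mul ((h.deriv i.2).mono hx)).add
      ((hS i.1).mul ((h.deriv' i.2).mono hx))).eq_integral hx.1
  have hl : ∑ i ∈ Finset.HasAntidiagonal.antidiagonal k,
      (coshTerm i.1 (x - x) * p i.2 x + sinhTerm i.1 (x - x) * p' i.2 x) = p k x := by
    rw [Finset.sum_eq_single (0, k)]
    · simp [coshTerm, sinhTerm]
    · rintro ⟨m, l⟩ hml hne
      have : m ≠ 0 := by
        rintro rfl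
        exact hne (by simpa using hml)
      simp [coshTerm, sinhTerm, this]
    · intro hn; simp at hn
  -- The coefficient form of `cosh (μ x) + sinh (μ x) = e^{μ x}`.
  have hr : ∑ i ∈ Finset.HasAntidiagonal.antidiagonal k,
      (coshTerm i.1 (x - 0) * p i.2 0 + sinhTerm i.1 (x - 0) * p' i.2 0)
      = (x : ℂ) ^ k / k.factorial := by
    have hz : ∀ l, p' l 0 = if l = 1 then 1 else 0 := fun l => by
      rw [h.zero']
      split_ifs <;> simp_all
    simp only [h.zero, hz, sub_zero]
    cases k with
    | zero => simp [coshTerm]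
    | succ k =>
      rw [Finset.sum_add_distrib, Finset.Nat.sum_antidiagonal_succ', Finset.Nat.sum_antidiagonal_succ']
      simp only [if_true, Nat.add_eq_zero_iff, one_ne_zero, and_false, if_false, mul_zero,
        Finset.sum_const_zero, add_zero, mul_one, Nat.add_eq_right, zero_ne_one, zero_add]
      have h1 : ((k + 1).factorial : ℂ) ≠ 0 := by exact_mod_cast (k + 1).factorial_ne_zero
      have : ∑ i ∈ Finset.HasAntidiagonal.antidiagonal k,
          sinhTerm i.1 x * (if i.2 = 0 then (1 : ℂ) else 0) = sinhTerm k x := by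
        rw [Finset.sum_eq_single (k, 0)]
        · simp
        · rintro ⟨m, l⟩ hml hne
          have : l ≠ 0 := by
            rintro rfl
            exact hne (by simpa using hml)
          simp [this]
        · intro hn; simp at hn
      rw [this, coshTerm, sinhTerm]
      field_simp
      ring
  rw [hl, hr] at key
  rw [key]
  congr 1
  refine intervalIntegral.integral_congr fun s _ => ?_
  -- The derivative of `coshTerm` and the inhomogeneity of `p''` each contribute a shift by two;
  -- these cancel and only the `q` term remains.
  have e := sum_shiftTwo_mul (fun m => sinhTerm m (x - s)) (fun m => p m s) k
  simp only [← shiftTwo_apply] at e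
  simp only [Finset.sum_add_distrib, mul_add, neg_mul, Finset.sum_neg_distrib, e]
  simp only [shiftTwo_apply (p := p), Finset.mul_sum, mul_left_comm (q s : ℂ)]
  ring

theorem IsTaylorFamily.eq_integral_kernel {p p' : ℕ → ℝ → ℂ} (hd : 0 ≤ d) (hq : IsPotential d q)
    (h : IsTaylorFamily d q 0 p p') (k : ℕ) {x : ℝ} (hx : x ∈ Icc 0 d) :
    p k x = (x : ℂ) ^ k / k.factorial + ∫ y, kernel q x y * ((y : ℂ) ^ k / k.factorial) := by
  have hc : ∀ k : ℕ, Continuous fun y : ℝ => (y : ℂ) ^ k / k.factorial := fun k => by fun_prop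
  refine volterra_unique hd hq.integrable continuous_sinhTerm (X := p)
    (Y := fun k x => (x : ℂ) ^ k / k.factorial
      + ∫ y, kernel q x y * ((y : ℂ) ^ k / k.factorial))
    (h := fun k x => (x : ℂ) ^ k / k.factorial) ?_ ?_ ?_ ?_ k x hx
  · exact fun k => .of_continuousOn ((h.deriv k).continuousOn hd)
  · exact fun k => (BoundedMeasurable.of_continuousOn (hc k).continuousOn).add
      (boundedMeasurable_integral_kernel hd hq (hc k))
  · exact fun k x hx => h.eq_integral k hx
  · intro k x hx
    congr 1
    rw [integral_kernel_mul hd hq (hc k) hx.1]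
    refine intervalIntegral.integral_congr fun s _ => ?_
    simp only [halfIntegral_pow, Finset.mul_sum, mul_left_comm (kernel q s _)]
    rw [integral_finsetSum _ fun i _ => (integrable_kernel_mul hd hq (hc i.2) s).const_mul _]
    simp only [integral_const_mul, Finset.mul_sum, mul_add, Finset.sum_add_distrib]

/-! ### Zero-free solutions and their formal powers. -/

theorem HasACDeriv.conj {F f : ℝ → ℂ} (h : HasACDeriv d F f) :
    HasACDeriv d (fun x => conj (F x)) (fun x => conj (f x)) where
  ac := by
    have := h.ac
    unfold AbsolutelyContinuousOnInterval at this ⊢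
    simpa only [Complex.dist_conj_conj] using this
  deriv := by
    filter_upwards [h.deriv] with x hx hx'
    exact (hx hx').star_conj
  int := by
    have := h.int
    rw [intervalIntegrable_iff] at this ⊢
    exact (Complex.conjCLE : ℂ →L[ℝ] ℂ).integrable_comp this

/-- A solution with non-real initial logarithmic derivative has no zeros. -/
theorem ne_zero_of_wronskian {f f' : ℝ → ℂ} (hf : HasACDeriv d f f')
    (hf' : HasACDeriv d f' fun s => (q s : ℂ) * f s)
    (h0 : f 0 * conj (f' 0) - f' 0 * conj (f 0) ≠ 0) {x : ℝ} (hx : x ∈ Icc 0 d) : f x ≠ 0 := by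
  intro hzero
  -- As `q` is real, the Wronskian of `f` and its conjugate is constant; a zero of `f` would make it
  -- vanish.
  have key := (((hf.mono hx).mul (hf'.mono hx).conj).sub
    ((hf'.mono hx).mul (hf.mono hx).conj)).eq_integral hx.1
  have hint : ∀ s, f' s * conj (f' s) + f s * conj ((q s : ℂ) * f s)
      - ((q s : ℂ) * f s * conj (f s) + f' s * conj (f' s)) = 0 := fun s => by
    rw [map_mul, Complex.conj_ofReal]; ring
  simp only [hint, hzero, map_zero, zero_mul, mul_zero, sub_zero, intervalIntegral.integral_zero,
    add_zero] at key
  exact h0 key.symm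

/-- The recursive integral that enters the formal power of index `k`. -/
noncomputable def powerFactor (f : ℝ → ℂ) (k : ℕ) : ℝ → ℂ :=
  if Odd k then recX f k else recXtilde f k

/-- The other recursive integral of index `k`. -/
noncomputable def coPowerFactor (f : ℝ → ℂ) (k : ℕ) : ℝ → ℂ :=
  if Odd k then recXtilde f k else recX f k

theorem powerFactor_zero (f : ℝ → ℂ) : powerFactor f 0 = fun _ => 1 := by
  ext x; simp [powerFactor, recXtilde]

theorem coPowerFactor_zero (f : ℝ → ℂ) : coPowerFactor f 0 = fun _ => 1 := by
  ext x; simp [coPowerFactor, recX]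

/-- Regrouping by parity removes the alternating exponent: the weight is always `f⁻²` here and
always `f²` in `coPowerFactor_succ`. -/
theorem powerFactor_succ (f : ℝ → ℂ) (k : ℕ) : powerFactor f (k + 1) =
    fun x => (k + 1) * ∫ s in (0 : ℝ)..x, coPowerFactor f k s * (f s ^ 2)⁻¹ := by
  ext x
  rcases Nat.even_or_odd k with h | h
  · have h1 : ¬ Odd k := Nat.not_odd_iff_even.2 h
    simp [powerFactor, coPowerFactor, h.add_one, h1, recX, h.add_one.neg_one_pow]
  · have h1 : ¬ Odd (k + 1) := Nat.not_odd_iff_even.2 h.add_one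
    simp [powerFactor, coPowerFactor, h, h1, recXtilde, h.neg_one_pow]

theorem coPowerFactor_succ (f : ℝ → ℂ) (k : ℕ) : coPowerFactor f (k + 1) =
    fun x => (k + 1) * ∫ s in (0 : ℝ)..x, powerFactor f k s * f s ^ 2 := by
  ext x
  rcases Nat.even_or_odd k with h | h
  · have h1 : ¬ Odd k := Nat.not_odd_iff_even.2 h
    simp [powerFactor, coPowerFactor, h.add_one, h1, recXtilde, h.neg_one_pow]
  · have h1 : ¬ Odd (k + 1) := Nat.not_odd_iff_even.2 h.add_one
    simp [powerFactor, coPowerFactor, h, h1, recX, h.add_one.neg_one_pow]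

theorem formalPower_eq (f : ℝ → ℂ) (k : ℕ) (x : ℝ) :
    formalPower f k x = f x * powerFactor f k x := by
  unfold formalPower powerFactor
  split_ifs <;> rfl

/-- The derivative of `formalPower f k`, where `f'` is the derivative of `f`. -/
noncomputable def formalPowerDeriv (f f' : ℝ → ℂ) : ℕ → ℝ → ℂ
  | 0, x => f' x
  | k + 1, x => f' x * powerFactor f (k + 1) x + (k + 1) * (coPowerFactor f k x * (f x)⁻¹)

section FormalPower

variable {f f' : ℝ → ℂ}

theorem continuousOn_powerFactor (hd : 0 ≤ d) (hf : ContinuousOn f (Icc 0 d))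
    (hne : ∀ x ∈ Icc 0 d, f x ≠ 0) (k : ℕ) :
    ContinuousOn (powerFactor f k) (Icc 0 d) ∧ ContinuousOn (coPowerFactor f k) (Icc 0 d) := by
  induction k with
  | zero =>
    rw [powerFactor_zero, coPowerFactor_zero]
    exact ⟨continuousOn_const, continuousOn_const⟩
  | succ k ih =>
    rw [powerFactor_succ, coPowerFactor_succ]
    constructor
    · refine continuousOn_const.mul (HasACDeriv.continuousOn (HasACDeriv.integral hd ?_) hd)
      refine ContinuousOn.intervalIntegrable ?_
      rw [uIcc_of_le hd]
      exact ih.2.mul ((hf.pow 2).inv₀ fun x hx => pow_ne_zero 2 (hne x hx))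
    · refine continuousOn_const.mul (HasACDeriv.continuousOn (HasACDeriv.integral hd ?_) hd)
      refine ContinuousOn.intervalIntegrable ?_
      rw [uIcc_of_le hd]
      exact ih.1.mul (hf.pow 2)

theorem hasACDeriv_powerFactor (hd : 0 ≤ d) (hf : ContinuousOn f (Icc 0 d))
    (hne : ∀ x ∈ Icc 0 d, f x ≠ 0) (k : ℕ) : HasACDeriv d (powerFactor f (k + 1))
      (fun s => (k + 1) * (coPowerFactor f k s * (f s ^ 2)⁻¹)) := by
  rw [powerFactor_succ]
  refine (HasACDeriv.integral hd ?_).const_mul _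
  refine ContinuousOn.intervalIntegrable ?_
  rw [uIcc_of_le hd]
  exact (continuousOn_powerFactor hd hf hne k).2.mul
    ((hf.pow 2).inv₀ fun x hx => pow_ne_zero 2 (hne x hx))

theorem hasACDeriv_coPowerFactor (hd : 0 ≤ d) (hf : ContinuousOn f (Icc 0 d))
    (hne : ∀ x ∈ Icc 0 d, f x ≠ 0) (k : ℕ) : HasACDeriv d (coPowerFactor f (k + 1))
      (fun s => (k + 1) * (powerFactor f k s * f s ^ 2)) := by
  rw [coPowerFactor_succ]
  refine (HasACDeriv.integral hd ?_).const_mul _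
  refine ContinuousOn.intervalIntegrable ?_
  rw [uIcc_of_le hd]
  exact (continuousOn_powerFactor hd hf hne k).1.mul (hf.pow 2)

/-- The formal powers of a zero-free solution form a Taylor family. -/
theorem isTaylorFamily_formalPower (hd : 0 ≤ d)
    (hf : ∀ x ∈ Icc 0 d, HasDerivWithinAt f (f' x) (Icc 0 d) x)
    (hf' : HasACDeriv d f' fun s => (q s : ℂ) * f s) (hne : ∀ x ∈ Icc 0 d, f x ≠ 0)
    (h0 : f 0 = 1) : IsTaylorFamily d q (f' 0) (fun k x => (k.factorial : ℂ)⁻¹ * formalPower f k x)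
      (fun k x => (k.factorial : ℂ)⁻¹ * formalPowerDeriv f f' k x) := by
  have hfc : ContinuousOn f (Icc 0 d) := fun x hx => (hf x hx).continuousWithinAt
  have hf'c := hf'.continuousOn hd
  have hfa : HasACDeriv d f f' := .of_hasDerivWithinAt hd hf hf'c
  have hinv : HasACDeriv d (fun x => (f x)⁻¹) (fun x => -f' x / f x ^ 2) :=
    .of_hasDerivWithinAt hd (fun x hx => (hf x hx).fun_inv (hne x hx))
      (hf'c.neg.div (hfc.pow 2) fun x hx => pow_ne_zero 2 (hne x hx))
  have hG := hasACDeriv_powerFactor hd hfc hne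
  have hH := hasACDeriv_coPowerFactor hd hfc hne
  constructor
  · intro k
    refine HasACDeriv.const_mul _ ?_
    rw [show formalPower f k = fun x => f x * powerFactor f k x from
      funext fun x => formalPower_eq f k x]
    match k with
    | 0 =>
      simp only [powerFactor_zero, mul_one]
      exact hfa
    | k + 1 =>
      refine (hfa.mul (hG k)).congr_ae (Eventually.of_forall fun x hx => ?_) hd
      have := hne x (Ioo_subset_Icc_self hx)
      simp only [formalPowerDeriv]
      field_simp
  · intro k
    match k with
    | 0 => simpa [powerFactor_zero, formalPowerDeriv, formalPower_eq, shiftTwo] using hf'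
    | 1 =>
      have h : HasACDeriv d (fun x => f' x * powerFactor f 1 x + (f x)⁻¹)
          (fun s => (q s : ℂ) * formalPower f 1 s) := by
        refine ((hf'.mul (hG 0)).add hinv).congr_ae (Eventually.of_forall fun x hx => ?_) hd
        have := hne x (Ioo_subset_Icc_self hx)
        simp only [coPowerFactor_zero, formalPower_eq, zero_add]
        field_simp
        push_cast
        ring
      simpa [formalPowerDeriv, shiftTwo, coPowerFactor_zero] using h
    | k + 2 =>
      -- With `G`, `H` the two factors, `(f G)' = f' G + (k + 2) H / f`. In the next derivative the
      -- `f' H / f²` terms cancel, and `H' / f` yields `(k + 2) (k + 1)` times the formal power of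
      -- index `k`.
      have h := ((hf'.mul (hG (k + 1))).add
        (((hH k).mul hinv).const_mul ((k + 1 : ℕ) + 1 : ℂ))).const_mul ((k + 2).factorial : ℂ)⁻¹
      refine h.congr_ae (Eventually.of_forall fun x hx => ?_) hd
      have := hne x (Ioo_subset_Icc_self hx)
      have h1 : (k.factorial : ℂ) ≠ 0 := by exact_mod_cast k.factorial_ne_zero
      have h2 : (k + 1 : ℂ) ≠ 0 := by exact_mod_cast k.succ_ne_zero
      have h3 : (k + 1 + 1 : ℂ) ≠ 0 := by exact_mod_cast (k + 1).succ_ne_zero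
      simp only [shiftTwo, formalPower_eq, Nat.factorial_succ]
      push_cast
      field_simp
      ring
  · intro k
    match k with
    | 0 => simp [formalPower_eq, powerFactor_zero, h0]
    | k + 1 => simp [formalPower_eq, powerFactor_succ]
  · intro k
    match k with
    | 0 => simp [formalPowerDeriv]
    | 1 => simp [formalPowerDeriv, powerFactor_succ, coPowerFactor_zero, h0]
    | k + 2 => simp [formalPowerDeriv, powerFactor_succ, coPowerFactor_succ]

/-- The correction of a Taylor family to the normalization `p 0' 0 = 0`. -/
theorem IsTaylorFamily.correct {c : ℂ} {p p' : ℕ → ℝ → ℂ} (h : IsTaylorFamily d q c p p') :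
    IsTaylorFamily d q 0 (fun k x => p k x - (if Odd k then 0 else c) * p (k + 1) x)
      (fun k x => p' k x - (if Odd k then 0 else c) * p' (k + 1) x) := by
  constructor
  · exact fun k => (h.deriv k).sub ((h.deriv (k + 1)).const_mul _)
  · intro k
    -- The shift by two preserves parity, so the correction respects the recursion. It is limited to
    -- even `k`: at `k = 1` it would bring in `p 2`, whose equation contains `p 0`.
    convert (h.deriv' k).sub ((h.deriv' (k + 1)).const_mul (if Odd k then 0 else c)) using 2 with s
    match k with
    | 0 => simp [shiftTwo]; ring
    | 1 => simp [shiftTwo]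
    | k + 2 =>
      have : Odd (k + 2) ↔ Odd k := by simp [Nat.odd_add, parity_simps]
      simp only [shiftTwo, this]
      ring
  · intro k
    simp [h.zero]
  · intro k
    match k with
    | 0 => simp [h.zero']
    | 1 => simp [h.zero']
    | k + 2 => simp [h.zero']

end FormalPower

theorem SolvesIVP.exists_deriv {u : ℝ → ℂ} {α β : ℂ} (hd : 0 ≤ d) (hq : Integrable q)
    (h : SolvesIVP q d 0 α β u) : ∃ v, (∀ x ∈ Icc 0 d, HasDerivWithinAt u (v x) (Icc 0 d) x) ∧
      HasACDeriv d v (fun s => (q s : ℂ) * u s) ∧ u 0 = α ∧ v 0 = β := by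
  obtain ⟨v, h1, h2, h3, h4, h5⟩ := h
  refine ⟨v, h1, ⟨h2, ?_, ?_⟩, h4, h5⟩
  · filter_upwards [h3] with x hx hx'
    obtain ⟨w, hw, he⟩ := hx hx'
    rwa [show (q x : ℂ) * u x = w by linear_combination he]
  · refine hq.ofReal.intervalIntegrable.mul_continuousOn ?_
    rw [uIcc_of_le hd]
    exact fun x hx => (h1 x hx).continuousWithinAt

/-- If `f₀` has a zero, `f₀ + i f₁` has derivative `i` at `0`; the correction in `phi` is the one of
`IsTaylorFamily.correct` with `c = i`. -/
theorem exists_isTaylorFamily_phi (hd : 0 ≤ d) (hq : Integrable q) {f₀ f₁ : ℝ → ℂ}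
    (h₀ : SolvesIVP q d 0 1 0 f₀) (h₁ : SolvesIVP q d 0 0 1 f₁) :
    ∃ p', IsTaylorFamily d q 0 (fun k x => (k.factorial : ℂ)⁻¹ * phi d f₀ f₁ k x) p' := by
  obtain ⟨v₀, a1, a2, a3, a4⟩ := h₀.exists_deriv hd hq
  obtain ⟨v₁, b1, b2, b3, b4⟩ := h₁.exists_deriv hd hq
  by_cases hz : ∀ y ∈ Icc 0 d, f₀ y ≠ 0
  · have h := isTaylorFamily_formalPower hd a1 a2 hz a3
    rw [a4] at h
    simp only [phi, if_pos hz]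
    exact ⟨_, h⟩
  · have hf1 : ∀ x ∈ Icc 0 d, HasDerivWithinAt (fun y => f₀ y + Complex.I * f₁ y)
        (v₀ x + Complex.I * v₁ x) (Icc 0 d) x := fun x hx =>
      (a1 x hx).add ((b1 x hx).const_mul Complex.I)
    have hf2 : HasACDeriv d (fun x => v₀ x + Complex.I * v₁ x)
        fun s => (q s : ℂ) * (f₀ s + Complex.I * f₁ s) := by
      convert a2.add (b2.const_mul Complex.I) using 2
      ring
    -- The Wronskian at `0` is `-2 i`.
    have hne : ∀ x ∈ Icc 0 d, (fun y => f₀ y + Complex.I * f₁ y) x ≠ 0 := fun x hx =>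
      ne_zero_of_wronskian (HasACDeriv.of_hasDerivWithinAt hd hf1 (hf2.continuousOn hd)) hf2
        (by simp [a3, a4, b3, b4, Complex.ext_iff]; norm_num) hx
    have h := (isTaylorFamily_formalPower hd hf1 hf2 hne (by simp [a3, b3])).correct
    have e' : ∀ (k : ℕ) x, (k.factorial : ℂ)⁻¹ * phi d f₀ f₁ k x =
        (k.factorial : ℂ)⁻¹ * formalPower (fun y => f₀ y + Complex.I * f₁ y) k x -
        (if Odd k then 0 else v₀ 0 + Complex.I * v₁ 0) * (((k + 1).factorial : ℂ)⁻¹ *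
          formalPower (fun y => f₀ y + Complex.I * f₁ y) (k + 1) x) := by
      intro k x
      rw [phi, if_neg hz]
      split_ifs with hk
      · ring
      · have h1 : (k.factorial : ℂ) ≠ 0 := by exact_mod_cast k.factorial_ne_zero
        have h2 : (k + 1 : ℂ) ≠ 0 := by exact_mod_cast k.succ_ne_zero
        rw [a4, b4, Nat.factorial_succ]
        push_cast
        field_simp
        ring
    simp only [e']
    exact ⟨_, h⟩

/-- The formal powers are the images of the powers under the transmutation operator. -/
theorem phi_eq_integral_kernel (hd : 0 ≤ d) (hq : IsPotential d q) {f₀ f₁ : ℝ → ℂ}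
    (h₀ : SolvesIVP q d 0 1 0 f₀) (h₁ : SolvesIVP q d 0 0 1 f₁) (k : ℕ) {x : ℝ}
    (hx : x ∈ Icc 0 d) :
    phi d f₀ f₁ k x = (x : ℂ) ^ k + ∫ y, kernel q x y * (y : ℂ) ^ k := by
  obtain ⟨p', hp⟩ := exists_isTaylorFamily_phi hd hq.integrable h₀ h₁
  have h := hp.eq_integral_kernel hd hq k hx
  have h1 : (k.factorial : ℂ) ≠ 0 := by exact_mod_cast k.factorial_ne_zero
  simp only [← mul_div_assoc, integral_div] at h
  field_simp at h
  exact h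

/-! ### Injectivity of the Fourier transform. -/

/-- A real integrable function with vanishing Fourier transform vanishes. -/
theorem ae_eq_zero_of_real_fourier_eq_zero {g : ℝ → ℝ} (hg : Integrable g)
    (h : ∀ ω : ℝ, ∫ y, (g y : ℂ) * Complex.exp (-Complex.I * ω * y) = 0) : g =ᵐ[volume] 0 := by
  have hm : ∀ {f : ℝ → ℝ}, Integrable f → AEMeasurable (fun x => ENNReal.ofReal (f x)) := fun hf =>
    hf.aestronglyMeasurable.aemeasurable.ennreal_ofReal
  have hfin := isFiniteMeasure_withDensity_ofReal hg.hasFiniteIntegral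
  have hfin' := isFiniteMeasure_withDensity_ofReal hg.neg.hasFiniteIntegral
  have hint : ∀ {f : ℝ → ℝ}, Integrable f → ∀ t : ℝ, Integrable fun x =>
      (ENNReal.ofReal (f x)).toReal • Complex.exp (t * x * Complex.I) := by
    intro f hf t
    have h1 : Integrable fun x => ((max (f x) 0 : ℝ) : ℂ) := hf.pos_part.ofReal
    refine (h1.mul_bdd (c := 1) (g := fun x : ℝ => Complex.exp (t * x * Complex.I))
      (by fun_prop) (Eventually.of_forall fun x => ?_)).congr
      (Eventually.of_forall fun x => ?_)
    · rw [← Complex.ofReal_mul, Complex.norm_exp_ofReal_mul_I]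
    · simp [ENNReal.toReal_ofReal']
  -- The positive and negative parts of `g` are densities of finite measures with equal
  -- characteristic functions, hence of equal measures.
  have hchar : charFun (volume.withDensity fun x => ENNReal.ofReal (g x))
      = charFun (volume.withDensity fun x => ENNReal.ofReal ((-g) x)) := by
    ext t
    rw [charFun_apply_real, charFun_apply_real,
      integral_withDensity_eq_integral_toReal_smul₀ (hm hg) (by simp),
      integral_withDensity_eq_integral_toReal_smul₀ (hm hg.neg) (by simp), ← sub_eq_zero,
      ← integral_sub (hint hg t) (hint hg.neg t), ← h (-t)]
    refine integral_congr_ae (Eventually.of_forall fun x => ?_)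
    have e1 : max (g x) 0 - max (-g x) 0 = g x := by
      rcases le_total (g x) 0 with h0 | h0
      · rw [max_eq_right h0, max_eq_left (by linarith)]; ring
      · rw [max_eq_left h0, max_eq_right (by linarith)]; ring
    have e2 : (-Complex.I * ((-t : ℝ) : ℂ) * x) = t * x * Complex.I := by push_cast; ring
    simp only [ENNReal.toReal_ofReal', Pi.neg_apply, e2]
    rw [← sub_smul, e1, Complex.real_smul]
  have hμ := Measure.ext_of_charFun hchar
  have hlt : ∫⁻ x, ENNReal.ofReal (g x) ≠ ⊤ := by
    have := hfin.measure_univ_lt_top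
    rw [withDensity_apply _ MeasurableSet.univ, Measure.restrict_univ] at this
    exact this.ne
  filter_upwards [(withDensity_eq_iff (hm hg) (hm hg.neg) hlt).1 hμ] with x hx
  simp only [Pi.neg_apply] at hx
  rcases le_total (g x) 0 with h0 | h0
  · rw [ENNReal.ofReal_of_nonpos h0, eq_comm, ENNReal.ofReal_eq_zero] at hx
    simp only [Pi.zero_apply]; linarith
  · rw [ENNReal.ofReal_of_nonpos (show -g x ≤ 0 by linarith), ENNReal.ofReal_eq_zero] at hx
    simp only [Pi.zero_apply]; linarith

/-- Injectivity of the Fourier transform on integrable functions. -/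
theorem ae_eq_zero_of_fourier_eq_zero {f : ℝ → ℂ} (hf : Integrable f)
    (h : ∀ ω : ℝ, ∫ y, f y * Complex.exp (-Complex.I * ω * y) = 0) : f =ᵐ[volume] 0 := by
  have hi : ∀ {f : ℝ → ℂ}, Integrable f → ∀ ω : ℝ,
      Integrable fun y => f y * Complex.exp (-Complex.I * ω * y) := by
    intro f hf ω
    refine hf.mul_bdd (c := 1) (by fun_prop) (Eventually.of_forall fun x => ?_)
    rw [show -Complex.I * ω * x = ((-(ω * x) : ℝ) : ℂ) * Complex.I by push_cast; ring,
      Complex.norm_exp_ofReal_mul_I]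
  have hcf : Integrable fun y => conj (f y) :=
    (Complex.conjCLE : ℂ →L[ℝ] ℂ).integrable_comp hf
  -- Conjugation reflects the frequency, so the real and imaginary parts of `f` also have vanishing
  -- transforms.
  have hc : ∀ ω : ℝ, ∫ y, conj (f y) * Complex.exp (-Complex.I * ω * y) = 0 := by
    intro ω
    have h1 := congrArg conj (h (-ω))
    rw [← integral_conj, map_zero] at h1
    rw [← h1]
    refine integral_congr_ae (Eventually.of_forall fun y => ?_)
    simp [← Complex.exp_conj]
  have hre := ae_eq_zero_of_real_fourier_eq_zero hf.re fun ω => by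
    have : ∀ y, ((RCLike.re (f y) : ℝ) : ℂ) * Complex.exp (-Complex.I * ω * y) = 1 / 2 *
        (f y * Complex.exp (-Complex.I * ω * y) + conj (f y) * Complex.exp (-Complex.I * ω * y)) := by
      intro y
      have e : ((RCLike.re (f y) : ℝ) : ℂ) = (f y + conj (f y)) / 2 := Complex.re_eq_add_conj (f y)
      rw [e]; ring
    simp_rw [this]
    rw [integral_const_mul, integral_add (hi hf ω) (hi hcf ω), h, hc]; simp
  have him := ae_eq_zero_of_real_fourier_eq_zero hf.im fun ω => by
    have : ∀ y, ((RCLike.im (f y) : ℝ) : ℂ) * Complex.exp (-Complex.I * ω * y)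
        = 1 / (2 * Complex.I) *
        (f y * Complex.exp (-Complex.I * ω * y) - conj (f y) * Complex.exp (-Complex.I * ω * y)) := by
      intro y
      have e : ((RCLike.im (f y) : ℝ) : ℂ) = (f y - conj (f y)) / (2 * Complex.I) :=
        Complex.im_eq_sub_conj (f y)
      rw [e]; ring
    simp_rw [this]
    rw [integral_const_mul, integral_sub (hi hf ω) (hi hcf ω), h, hc]; simp
  filter_upwards [hre, him] with y h1 h2
  exact Complex.ext h1 h2

/-! ### The Laguerre polynomials as an orthonormal basis. -/

section Measure

variable {E : Type*} [NormedAddCommGroup E] [NormedSpace ℝ E]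

theorem integral_laguerreMeasure (g : ℝ → E) :
    ∫ t, g t ∂laguerreMeasure = ∫ t in Ioi (0 : ℝ), Real.exp (-t) • g t := by
  rw [laguerreMeasure, integral_withDensity_eq_integral_toReal_smul (by fun_prop) (by simp)]
  simp [ENNReal.toReal_ofReal, Real.exp_nonneg]

theorem integrable_laguerreMeasure {g : ℝ → E} :
    Integrable g laguerreMeasure ↔ IntegrableOn (fun t => Real.exp (-t) • g t) (Ioi 0) := by
  rw [laguerreMeasure, integrable_withDensity_iff_integrable_smul' (by fun_prop) (by simp)]
  simp [ENNReal.toReal_ofReal, Real.exp_nonneg, IntegrableOn]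

theorem ae_laguerreMeasure {p : ℝ → Prop} (h : ∀ᵐ t : ℝ, t ∈ Ioi 0 → p t) :
    ∀ᵐ t ∂laguerreMeasure, p t :=
  (withDensity_absolutelyContinuous _ _).ae_le ((ae_restrict_iff' measurableSet_Ioi).2 h)

end Measure

theorem integral_pow_laguerreMeasure (k : ℕ) :
    ∫ t, t ^ k ∂laguerreMeasure = (k.factorial : ℝ) := by
  rw [integral_laguerreMeasure, ← Real.Gamma_nat_eq_factorial, Real.Gamma_eq_integral (by positivity)]
  refine setIntegral_congr_fun measurableSet_Ioi fun t _ => ?_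
  simp

theorem integrableOn_pow_mul_exp (k : ℕ) {b : ℝ} (hb : 0 < b) :
    IntegrableOn (fun t : ℝ => t ^ k * Real.exp (-b * t)) (Ioi 0) := by
  have := integrableOn_rpow_mul_exp_neg_mul_rpow (p := 1) (s := k) (b := b)
    (by have : (0 : ℝ) ≤ k := by positivity
        linarith) one_pos hb
  simpa using this

/-- The square against `e^{-t}` still decays like `e^{-t/2}`. This is the majorant for frequency
shifts up to `1 / 4`. -/
theorem memLp_pow_mul_exp (k : ℕ) :
    MemLp (fun t : ℝ => t ^ k * Real.exp (t / 4)) 2 laguerreMeasure := by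
  rw [memLp_two_iff_integrable_sq (by fun_prop), integrable_laguerreMeasure]
  refine (integrableOn_pow_mul_exp (2 * k) (b := 1 / 2) (by norm_num)).congr_fun (fun t _ => ?_)
    measurableSet_Ioi
  simp only [smul_eq_mul]
  rw [show -(1 / 2) * t = -t + (t / 4 + t / 4) by ring, Real.exp_add, Real.exp_add]
  ring

theorem memLp_pow (k : ℕ) : MemLp (fun t : ℝ => t ^ k) 2 laguerreMeasure := by
  rw [memLp_two_iff_integrable_sq (by fun_prop), integrable_laguerreMeasure]
  refine (integrableOn_pow_mul_exp (2 * k) one_pos).congr_fun (fun t _ => ?_) measurableSet_Ioi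
  simp only [smul_eq_mul, neg_mul, one_mul]
  ring

theorem integrable_pow_laguerreMeasure (k : ℕ) :
    Integrable (fun t : ℝ => t ^ k) laguerreMeasure := by
  rw [integrable_laguerreMeasure]
  refine (integrableOn_pow_mul_exp k one_pos).congr_fun (fun t _ => ?_) measurableSet_Ioi
  simp only [smul_eq_mul, neg_mul, one_mul]
  ring

/-- The coefficients of the Laguerre polynomials. -/
noncomputable def laguerreCoeff (n k : ℕ) : ℝ := (-1) ^ k / (k.factorial : ℝ) * (n.choose k : ℝ)

theorem laguerre_eq (n : ℕ) (t : ℝ) :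
    laguerre n t = ∑ k ∈ Finset.range (n + 1), laguerreCoeff n k * t ^ k := rfl

theorem memLp_laguerre (n : ℕ) : MemLp (laguerre n) 2 laguerreMeasure := by
  rw [show laguerre n = fun t => ∑ k ∈ Finset.range (n + 1), laguerreCoeff n k * t ^ k from
    funext (laguerre_eq n)]
  exact memLp_finsetSum _ fun k _ => (memLp_pow k).const_mul _

theorem laguerreCoeff_self (n : ℕ) : laguerreCoeff n n = (-1) ^ n / n.factorial := by
  simp [laguerreCoeff]

/-- The moments are `(k + j)! = k! (k + 1) ⋯ (k + j)`, so the sum is an `n`-th finite difference of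
a polynomial of degree `j`. Orthogonality follows. -/
theorem integral_pow_mul_laguerre (j n : ℕ) :
    ∫ t, t ^ j * laguerre n t ∂laguerreMeasure =
      (-1) ^ n * (fwdDiff 1)^[n] (fun x => (ascPochhammer ℝ j).eval x) 1 := by
  have h1 : ∀ t : ℝ, t ^ j * laguerre n t
      = ∑ k ∈ Finset.range (n + 1), laguerreCoeff n k * t ^ (k + j) := fun t => by
    rw [laguerre_eq, Finset.mul_sum]
    exact Finset.sum_congr rfl fun k _ => by ring
  simp_rw [h1]
  rw [integral_finsetSum _ fun k _ => (integrable_pow_laguerreMeasure _).const_mul _,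
    fwdDiff_iter_eq_sum_shift, Finset.mul_sum]
  refine Finset.sum_congr rfl fun k hk => ?_
  have hk' : k ≤ n := by simpa [Nat.lt_succ_iff] using hk
  rw [integral_const_mul, integral_pow_laguerreMeasure, laguerreCoeff,
    ← Nat.factorial_mul_ascFactorial, ← ascPochhammer_nat_eq_ascFactorial]
  have h2 : (k.factorial : ℝ) ≠ 0 := by exact_mod_cast k.factorial_ne_zero
  have h3 : ((-1 : ℝ) ^ n) * (-1) ^ (n - k) = (-1) ^ k := by
    obtain ⟨m, rfl⟩ := Nat.exists_eq_add_of_le hk'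
    rw [Nat.add_sub_cancel_left, pow_add, mul_assoc, ← mul_pow]
    simp
  push_cast
  rw [zsmul_eq_mul, nsmul_eq_mul, mul_one, add_comm (1 : ℝ)]
  push_cast
  rw [← h3]
  field_simp

theorem integral_pow_mul_laguerre_of_lt {j n : ℕ} (h : j < n) :
    ∫ t, t ^ j * laguerre n t ∂laguerreMeasure = 0 := by
  rw [integral_pow_mul_laguerre, Polynomial.fwdDiff_iter_eq_zero_of_degree_lt
    (by rwa [ascPochhammer_natDegree])]
  simp

theorem integral_pow_mul_laguerre_self (n : ℕ) :
    ∫ t, t ^ n * laguerre n t ∂laguerreMeasure = (-1) ^ n * n.factorial := by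
  have h := Polynomial.fwdDiff_iter_degree_eq_factorial (ascPochhammer ℝ n)
  rw [ascPochhammer_natDegree, (monic_ascPochhammer ℝ n).leadingCoeff] at h
  rw [integral_pow_mul_laguerre]
  have := congrFun h 1
  simp only [one_smul] at this
  rw [this]
  simp

theorem integral_laguerre_mul_laguerre_of_le {m n : ℕ} (h : m ≤ n) :
    ∫ t, laguerre m t * laguerre n t ∂laguerreMeasure = if m = n then 1 else 0 := by
  simp_rw [laguerre_eq m, Finset.sum_mul, mul_assoc]
  have hi : ∀ k : ℕ, Integrable (fun t => t ^ k * laguerre n t) laguerreMeasure := fun k =>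
    (memLp_pow k).integrable_mul (memLp_laguerre n)
  rw [integral_finsetSum _ fun k _ => (hi k).const_mul _]
  simp only [integral_const_mul]
  rw [Finset.sum_range_succ, Finset.sum_eq_zero, zero_add]
  · split_ifs with hmn
    · subst hmn
      rw [integral_pow_mul_laguerre_self, laguerreCoeff_self]
      have h2 : (m.factorial : ℝ) ≠ 0 := by exact_mod_cast m.factorial_ne_zero
      field_simp
      rw [← pow_mul, mul_comm, pow_mul]
      simp
    · rw [integral_pow_mul_laguerre_of_lt (lt_of_le_of_ne h hmn), mul_zero]
  · intro k hk
    have : k < m := by simpa using hk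
    rw [integral_pow_mul_laguerre_of_lt (this.trans_le h), mul_zero]

theorem integral_laguerre_mul_laguerre (m n : ℕ) :
    ∫ t, laguerre m t * laguerre n t ∂laguerreMeasure = if m = n then 1 else 0 := by
  rcases le_total m n with h | h
  · exact integral_laguerre_mul_laguerre_of_le h
  · simp_rw [mul_comm (laguerre m _), integral_laguerre_mul_laguerre_of_le h, eq_comm]

theorem memLp_ofReal_laguerre (n : ℕ) :
    MemLp (fun t => (laguerre n t : ℂ)) 2 laguerreMeasure := (memLp_laguerre n).ofReal

/-- The Laguerre polynomials as elements of the Hilbert space. -/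
noncomputable def laguerreLp (n : ℕ) : Lp ℂ 2 laguerreMeasure := (memLp_ofReal_laguerre n).toLp _

theorem inner_laguerreLp (n : ℕ) {g : ℝ → ℂ} (hg : MemLp g 2 laguerreMeasure) :
    inner ℂ (laguerreLp n) (hg.toLp g) = ∫ t, (laguerre n t : ℂ) * g t ∂laguerreMeasure := by
  rw [L2.inner_def]
  refine integral_congr_ae ?_
  filter_upwards [(memLp_ofReal_laguerre n).coeFn_toLp, hg.coeFn_toLp] with t h1 h2
  rw [laguerreLp, h1, h2]
  simp [mul_comm]

theorem orthonormal_laguerreLp : Orthonormal ℂ laguerreLp := by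
  rw [orthonormal_iff_ite]
  intro m n
  rw [laguerreLp.eq_def n, inner_laguerreLp]
  simp_rw [← Complex.ofReal_mul]
  rw [integral_complex_ofReal, integral_laguerre_mul_laguerre]
  split_ifs <;> simp

/-- `L_n` has degree exactly `n`, so the monomials are recovered by induction. -/
theorem integral_pow_mul_eq_zero {h : ℝ → ℂ} (hh : MemLp h 2 laguerreMeasure)
    (h0 : ∀ n, ∫ t, (laguerre n t : ℂ) * h t ∂laguerreMeasure = 0) (n : ℕ) :
    ∫ t, (t : ℂ) ^ n * h t ∂laguerreMeasure = 0 := by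
  have hi : ∀ k : ℕ, Integrable (fun t : ℝ => (t : ℂ) ^ k * h t) laguerreMeasure := fun k => by
    have h1 : MemLp (fun t : ℝ => ((t ^ k : ℝ) : ℂ)) 2 laguerreMeasure := (memLp_pow k).ofReal
    simpa [Pi.mul_def] using h1.integrable_mul hh
  induction n using Nat.strong_induction_on with
  | _ n ih =>
    have h1 := h0 n
    simp_rw [laguerre_eq, Complex.ofReal_sum, Finset.sum_mul, Complex.ofReal_mul,
      Complex.ofReal_pow, mul_assoc] at h1
    rw [integral_finsetSum _ fun k _ => (hi k).const_mul _, Finset.sum_range_succ,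
      Finset.sum_eq_zero, zero_add, integral_const_mul] at h1
    · refine (mul_eq_zero.1 h1).resolve_left ?_
      rw [laguerreCoeff_self]
      exact Complex.ofReal_ne_zero.2 (div_ne_zero (pow_ne_zero _ (by norm_num)) (by positivity))
    · intro k hk
      rw [integral_const_mul, ih k (by simpa using hk), mul_zero]

/-- The factor `e^{-iδt}` is expanded and integrated termwise. All powers of `t` are carried along
so that the step can be repeated from the new frequency. -/
theorem integral_pow_mul_exp_mul_eq_zero_of_shift {h : ℝ → ℂ} (hh : MemLp h 2 laguerreMeasure)
    {ω δ : ℝ} (hδ : |δ| ≤ 1 / 4)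
    (h0 : ∀ n : ℕ, ∫ t, (t : ℂ) ^ n * (Complex.exp (-Complex.I * ω * t) * h t) ∂laguerreMeasure = 0)
    (n : ℕ) : ∫ t, (t : ℂ) ^ n * (Complex.exp (-Complex.I * (ω + δ : ℝ) * t) * h t)
      ∂laguerreMeasure = 0 := by
  have hpos : ∀ᵐ t ∂laguerreMeasure, 0 < t := ae_laguerreMeasure (Eventually.of_forall fun t ht => ht)
  have hmeas := hh.aestronglyMeasurable
  have hs := hasSum_integral_of_dominated_convergence (μ := laguerreMeasure)
    (F := fun (m : ℕ) (t : ℝ) => (-Complex.I * δ) ^ m / m.factorial *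
      ((t : ℂ) ^ (m + n) * (Complex.exp (-Complex.I * ω * t) * h t)))
    (f := fun t : ℝ => (t : ℂ) ^ n * (Complex.exp (-Complex.I * (ω + δ : ℝ) * t) * h t))
    (fun (m : ℕ) (t : ℝ) => (t / 4) ^ m / m.factorial * (t ^ n * ‖h t‖)) ?_ ?_ ?_ ?_ ?_
  · simp only [integral_const_mul, h0, mul_zero] at hs
    exact hs.unique hasSum_zero
  · intro m
    exact AEStronglyMeasurable.mul (by fun_prop) (AEStronglyMeasurable.mul (by fun_prop)
      (AEStronglyMeasurable.mul (by fun_prop) hmeas))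
  · intro m
    filter_upwards [hpos] with t ht
    have e1 : ‖Complex.exp (-Complex.I * ω * t)‖ = 1 := by
      rw [show -Complex.I * ω * t = ((-(ω * t) : ℝ) : ℂ) * Complex.I by push_cast; ring,
        Complex.norm_exp_ofReal_mul_I]
    simp only [norm_mul, norm_div, norm_pow, norm_neg, Complex.norm_I, one_mul, Complex.norm_real,
      Real.norm_eq_abs, e1, abs_of_pos ht, Complex.norm_natCast]
    have : |δ| ^ m ≤ (1 / 4) ^ m := by gcongr
    calc |δ| ^ m / m.factorial * (t ^ (m + n) * ‖h t‖)
        ≤ (1 / 4) ^ m / m.factorial * (t ^ (m + n) * ‖h t‖) := by gcongr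
      _ = _ := by rw [div_pow, div_pow, pow_add]; ring
  · exact Eventually.of_forall fun t => (Real.summable_pow_div_factorial _).mul_right _
  · have he : ∀ t : ℝ, ∑' m : ℕ, (t / 4) ^ m / m.factorial * (t ^ n * ‖h t‖)
        = (t ^ n * Real.exp (t / 4)) * ‖h t‖ := fun t => by
      rw [tsum_mul_right, Real.exp_eq_exp_ℝ, (NormedSpace.expSeries_div_hasSum_exp (t / 4)).tsum_eq]
      ring
    simp_rw [he]
    exact (memLp_pow_mul_exp n).integrable_mul hh.norm
  · refine Eventually.of_forall fun t => ?_
    have h1 := (NormedSpace.expSeries_div_hasSum_exp (-Complex.I * δ * t)).mul_right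
      ((t : ℂ) ^ n * (Complex.exp (-Complex.I * ω * t) * h t))
    rw [← Complex.exp_eq_exp_ℂ] at h1
    rw [Complex.ofReal_add, mul_add, add_mul, Complex.exp_add,
      show ∀ a b c e : ℂ, a * (b * c * e) = c * (a * (b * e)) from fun a b c e => by ring]
    refine (congrArg (fun f : ℕ → ℂ => HasSum f _) (funext fun m => ?_)).mpr h1
    rw [mul_pow (-Complex.I * δ), pow_add]
    ring

/-- Completeness of the Laguerre polynomials. -/
theorem ae_eq_zero_of_integral_laguerre_mul_eq_zero {h : ℝ → ℂ} (hh : MemLp h 2 laguerreMeasure)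
    (h0 : ∀ n, ∫ t, (laguerre n t : ℂ) * h t ∂laguerreMeasure = 0) :
    h =ᵐ[laguerreMeasure] 0 := by
  -- Any frequency is reached from `0` by finitely many shifts of size at most `1 / 4`.
  have hstep : ∀ {δ : ℝ}, |δ| ≤ 1 / 4 → ∀ j n : ℕ, ∫ t, (t : ℂ) ^ n *
      (Complex.exp (-Complex.I * (j * δ : ℝ) * t) * h t) ∂laguerreMeasure = 0 := by
    intro δ hδ j
    induction j with
    | zero => intro n; simpa using integral_pow_mul_eq_zero hh h0 n
    | succ j ih =>
      intro n
      rw [show ((j + 1 : ℕ) * δ : ℝ) = j * δ + δ by push_cast; ring]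
      exact integral_pow_mul_exp_mul_eq_zero_of_shift hh hδ ih n
  have hall : ∀ ω : ℝ, ∫ t, Complex.exp (-Complex.I * ω * t) * h t ∂laguerreMeasure = 0 := by
    intro ω
    obtain ⟨N, hN⟩ := exists_nat_gt (4 * |ω|)
    have hN0 : (0 : ℝ) < N := lt_of_le_of_lt (by positivity) hN
    have := hstep (δ := ω / N) (by
      rw [abs_div, abs_of_pos hN0, div_le_iff₀ hN0]; linarith) N 0
    rw [mul_div_cancel₀ _ hN0.ne'] at this
    simpa using this
  have hint : Integrable h laguerreMeasure := by
    have := (memLp_pow 0).ofReal (K := ℂ) |>.integrable_mul hh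
    simpa [Pi.mul_def] using this
  rw [integrable_laguerreMeasure] at hint
  have key := ae_eq_zero_of_fourier_eq_zero ((integrable_indicator_iff measurableSet_Ioi).2 hint)
    fun ω => by
      have := hall ω
      rw [integral_laguerreMeasure, ← integral_indicator measurableSet_Ioi] at this
      rw [← this]
      refine integral_congr_ae (Eventually.of_forall fun t => ?_)
      by_cases ht : t ∈ Ioi (0 : ℝ)
      · simp only [indicator_of_mem ht, Complex.real_smul]; ring
      · simp only [indicator_of_notMem ht, zero_mul]
  refine ae_laguerreMeasure ?_
  filter_upwards [key] with t ht ht0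
  rw [indicator_of_mem ht0] at ht
  exact (smul_eq_zero.1 ht).resolve_left (Real.exp_pos _).ne'

theorem orthogonal_span_laguerreLp : (Submodule.span ℂ (Set.range laguerreLp))ᗮ = ⊥ := by
  rw [Submodule.eq_bot_iff]
  intro h hh
  have hm := Lp.memLp h
  have h1 := ae_eq_zero_of_integral_laguerre_mul_eq_zero hm fun n => by
    rw [← inner_laguerreLp n hm, Lp.toLp_coeFn]
    exact (Submodule.mem_orthogonal _ _).1 hh _ (Submodule.subset_span ⟨n, rfl⟩)
  exact (Lp.eq_zero_iff_ae_eq_zero).2 h1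

/-- The Laguerre coefficients of a square integrable function. -/
theorem hasLaguerreExpansion_iff {g : ℝ → ℂ} (hg : MemLp g 2 laguerreMeasure) {a : ℕ → ℂ} :
    HasLaguerreExpansion g a ↔
      ∀ n, a n = ∫ t, (laguerre n t : ℂ) * g t ∂laguerreMeasure := by
  have hmem : ∀ N : ℕ, MemLp (fun t => ∑ n ∈ Finset.range N, a n * (laguerre n t : ℂ)) 2
      laguerreMeasure := fun N => memLp_finsetSum _ fun n _ => (memLp_ofReal_laguerre n).const_mul _
  have hLp : ∀ N : ℕ, (hmem N).toLp _ = ∑ n ∈ Finset.range N, a n • laguerreLp n := by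
    intro N
    refine Lp.ext ?_
    have h1 : ∀ n, (a n • laguerreLp n : Lp ℂ 2 laguerreMeasure) =
        ((memLp_ofReal_laguerre n).const_mul (a n)).toLp _ := fun n =>
      (MemLp.toLp_const_smul (a n) (memLp_ofReal_laguerre n)).symm
    induction N with
    | zero =>
      filter_upwards [(hmem 0).coeFn_toLp, Lp.coeFn_zero ℂ 2 laguerreMeasure] with t e1 e2
      rw [e1]
      simp only [Finset.range_zero, Finset.sum_empty]
      rw [e2]; rfl
    | succ N ih =>
      rw [Finset.sum_range_succ]
      filter_upwards [(hmem (N + 1)).coeFn_toLp, (hmem N).coeFn_toLp, ih, Lp.coeFn_add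
        (∑ n ∈ Finset.range N, a n • laguerreLp n) (a N • laguerreLp N),
        ((memLp_ofReal_laguerre N).const_mul (a N)).coeFn_toLp] with t e1 e2 e3 e4 e5
      rw [e1, e4, Pi.add_apply, ← e3, e2, h1, e5, Finset.sum_range_succ]
  have hiff : HasLaguerreExpansion g a ↔ Tendsto (fun N => ∑ n ∈ Finset.range N, a n • laguerreLp n)
      atTop (𝓝 (hg.toLp g)) := by
    simp_rw [← hLp]
    rw [Lp.tendsto_Lp_iff_tendsto_eLpNorm'' _ hmem g hg]
    simp_rw [eLpNorm_sub_comm _ g]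
    exact ⟨fun h => h.2, fun h => ⟨hg, h⟩⟩
  rw [hiff]
  constructor
  · intro h n
    -- By orthonormality, pairing the partial sums with `laguerreLp n` gives `a n` as soon as `N >
    -- n`; continuity passes to the limit.
    have h1 := ((continuous_const (y := laguerreLp n)).inner continuous_id (𝕜 := ℂ)).tendsto
      (hg.toLp g) |>.comp h
    rw [← inner_laguerreLp n hg]
    refine tendsto_nhds_unique (tendsto_const_nhds.congr' ?_) h1
    filter_upwards [eventually_gt_atTop n] with N hN
    simp only [Function.comp, id]
    rw [orthonormal_laguerreLp.inner_right_sum _ (Finset.mem_range.2 hN)]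
  · intro h
    let b := HilbertBasis.mkOfOrthogonalEqBot orthonormal_laguerreLp orthogonal_span_laguerreLp
    have hb := (b.hasSum_repr (hg.toLp g)).tendsto_sum_nat
    refine hb.congr fun N => Finset.sum_congr rfl fun n _ => ?_
    rw [b.repr_apply_apply, HilbertBasis.coe_mkOfOrthogonalEqBot, inner_laguerreLp, h]

/-! ### Existence and uniqueness of the kernel, and its Laguerre coefficients. -/

/-- The kernel needs a Borel potential on the whole line. Changing `q` on a null set of `(0, d)` and
outside it affects no solution, by `SolvesIVP.congr`. -/
theorem exists_isPotential (hq : IntegrableOn q (Ioo 0 d)) :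
    ∃ q', IsPotential d q' ∧ ∀ᵐ x : ℝ, x ∈ Ioo 0 d → q x = q' x := by
  refine ⟨(Ioo 0 d).indicator (hq.1.mk q), ⟨?_, ?_, ?_⟩, ?_⟩
  · exact hq.1.stronglyMeasurable_mk.measurable.indicator measurableSet_Ioo
  · exact (integrable_indicator_iff measurableSet_Ioo).2 (Integrable.congr hq hq.1.ae_eq_mk)
  · exact fun s hs => indicator_of_notMem hs _
  · filter_upwards [(ae_restrict_iff' measurableSet_Ioo).1 hq.1.ae_eq_mk] with x hx hx'
    rw [indicator_of_mem hx', hx hx']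

theorem SolvesIVP.congr {q' : ℝ → ℝ} {lam α β : ℂ} {u : ℝ → ℂ} (h : SolvesIVP q d lam α β u)
    (hqq : ∀ᵐ x : ℝ, x ∈ Ioo 0 d → q x = q' x) : SolvesIVP q' d lam α β u := by
  obtain ⟨v, h1, h2, h3, h4⟩ := h
  refine ⟨v, h1, h2, ?_, h4⟩
  filter_upwards [h3, hqq] with x hx hx' hx''
  rw [← hx' hx'']
  exact hx hx''

theorem stronglyMeasurable_kernel_right (hd : 0 ≤ d) (hq : IsPotential d q) (x : ℝ) :
    StronglyMeasurable (kernel q x) :=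
  (stronglyMeasurable_kernel hd hq).comp_measurable (show Measurable fun y => (x, y) by fun_prop)

theorem integrable_kernel (hd : 0 ≤ d) (hq : IsPotential d q) (x : ℝ) :
    Integrable (kernel q x) := by
  simpa using integrable_kernel_mul hd hq (continuous_const (y := (1 : ℂ))) x

theorem memLp_kernel (hd : 0 ≤ d) (hq : IsPotential d q) (x : ℝ) :
    MemLp (kernel q x) 2 volume := by
  refine (memLp_indicator_const 2 (measurableSet_Icc (a := -x) (b := x))
    (∑' n, kernelBound d q n) (Or.inr (by simp))).mono'
    (stronglyMeasurable_kernel_right hd hq x).aestronglyMeasurable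
    (Eventually.of_forall fun y => ?_)
  by_cases hy : |y| ≤ x
  · rw [indicator_of_mem (by exact abs_le.1 hy)]
    exact norm_kernel_le hd hq x y
  · rw [kernel_eq_zero hq hy, norm_zero, indicator_of_notMem (show y ∉ Icc (-x) x from fun h => hy (abs_le.2 h))]

theorem setIntegral_kernel_mul (hq : IsPotential d q) (x : ℝ) (g : ℝ → ℂ) :
    ∫ y in Iio x, kernel q x y * g y = ∫ y, kernel q x y * g y := by
  rw [← integral_Iic_eq_integral_Iio]
  refine setIntegral_eq_integral_of_forall_compl_eq_zero fun y hy => ?_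
  rw [kernel_eq_zero hq fun h => hy ((le_abs_self y).trans h), zero_mul]

theorem isTransmutationKernel_kernel (hd : 0 ≤ d) (hq : IsPotential d q) {u : ℝ → ℝ → ℂ}
    (hu : ∀ ω : ℝ, SolvesIVP q d ((ω : ℂ) ^ 2) 1 (-Complex.I * ω) (u ω)) :
    IsTransmutationKernel d u (kernel q) := fun x hx =>
  ⟨(memLp_kernel hd hq x).restrict _, (integrable_kernel hd hq x).integrableOn, fun ω => by
    rw [(hu ω).eq_exp_add_integral_kernel hd hq hx, setIntegral_kernel_mul hq]⟩

/-- Two transmutation kernels agree almost everywhere. -/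
theorem IsTransmutationKernel.ae_eq {u : ℝ → ℝ → ℂ} {A B : ℝ → ℝ → ℂ}
    (hA : IsTransmutationKernel d u A) (hB : IsTransmutationKernel d u B) {x : ℝ}
    (hx : x ∈ Icc 0 d) : ∀ᵐ y : ℝ, y ∈ Iio x → A x y = B x y := by
  obtain ⟨-, a2, a3⟩ := hA x hx
  obtain ⟨-, b2, b3⟩ := hB x hx
  have hi : ∀ {f : ℝ → ℂ}, IntegrableOn f (Iio x) → ∀ ω : ℝ,
      IntegrableOn (fun y => f y * Complex.exp (-Complex.I * ω * y)) (Iio x) := by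
    intro f hf ω
    refine Integrable.mul_bdd (c := 1) hf (by fun_prop) (Eventually.of_forall fun x => ?_)
    rw [show -Complex.I * ω * x = ((-(ω * x) : ℝ) : ℂ) * Complex.I by push_cast; ring,
      Complex.norm_exp_ofReal_mul_I]
  have key := ae_eq_zero_of_fourier_eq_zero
    ((integrable_indicator_iff measurableSet_Iio).2 (a2.sub b2)) fun ω => by
      have h : ∫ y in Iio x, (A x y - B x y) * Complex.exp (-Complex.I * ω * y) = 0 := by
        simp_rw [sub_mul]
        rw [integral_sub (hi a2 ω) (hi b2 ω), sub_eq_zero]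
        exact add_left_cancel ((a3 ω).symm.trans (b3 ω))
      rw [← integral_indicator measurableSet_Iio] at h
      rw [← h]
      refine integral_congr_ae (Eventually.of_forall fun y => ?_)
      by_cases hy : y ∈ Iio x
      · simp only [indicator_of_mem hy, Pi.sub_apply]
      · simp only [indicator_of_notMem hy, zero_mul]
  filter_upwards [key] with y hy hy'
  rw [indicator_of_mem hy'] at hy
  exact sub_eq_zero.1 hy

theorem ae_laguerreMeasure_comp_sub {x : ℝ} {p : ℝ → Prop} (h : ∀ᵐ y : ℝ, y ∈ Iio x → p y) :
    ∀ᵐ t ∂laguerreMeasure, p (x - t) := by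
  refine ae_laguerreMeasure ?_
  have h1 := (Measure.measurePreserving_sub_left volume x).quasiMeasurePreserving.ae h
  filter_upwards [h1] with t ht ht0
  exact ht (by simpa using ht0)

/-- The support condition forces `0 ≤ t ≤ 2 x`, so the exponential is at most `e^{2x}`. -/
theorem memLp_kernel_mul_exp (hd : 0 ≤ d) (hq : IsPotential d q) (x : ℝ) :
    MemLp (fun t : ℝ => kernel q x (x - t) * Complex.exp (t : ℂ)) 2 laguerreMeasure := by
  have h1 := (memLp_pow 0).const_mul ((∑' n, kernelBound d q n) * Real.exp (2 * x))
  refine h1.mono' ?_ (Eventually.of_forall fun t => ?_)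
  · exact (((stronglyMeasurable_kernel_right hd hq x).comp_measurable
      (show Measurable fun t => x - t by fun_prop)).mul
      (show Continuous fun t : ℝ => Complex.exp (t : ℂ) by fun_prop).stronglyMeasurable).aestronglyMeasurable
  · have hS : 0 ≤ ∑' n, kernelBound d q n := tsum_nonneg (kernelBound_nonneg hd)
    rw [pow_zero, mul_one]
    by_cases hy : |x - t| ≤ x
    · rw [norm_mul, Complex.norm_exp, Complex.ofReal_re]
      have := (abs_le.1 hy).1
      have h2 := norm_kernel_le hd hq x (x - t)
      gcongr
      linarith
    · rw [kernel_eq_zero hq hy, zero_mul, norm_zero]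
      positivity

/-- The factor `e^t` cancels the weight, and `y = x - t`. -/
theorem integral_laguerre_mul_kernel (hq : IsPotential d q) (n : ℕ) (x : ℝ) :
    ∫ t, (laguerre n t : ℂ) * (kernel q x (x - t) * Complex.exp (t : ℂ)) ∂laguerreMeasure
      = ∫ y, kernel q x y * (laguerre n (x - y) : ℂ) := by
  rw [integral_laguerreMeasure, ← integral_sub_left_eq_self _ volume x]
  have h : ∀ t : ℝ, Real.exp (-t) • ((laguerre n t : ℂ) *
      (kernel q x (x - t) * Complex.exp (t : ℂ))) = kernel q x (x - t) * (laguerre n t : ℂ) := by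
    intro t
    have e : ((Real.exp (-t) : ℝ) : ℂ) * Complex.exp (t : ℂ) = 1 := by
      rw [Complex.ofReal_exp, ← Complex.exp_add]; simp
    rw [Complex.real_smul]
    linear_combination (laguerre n t : ℂ) * kernel q x (x - t) * e
  simp_rw [h, sub_sub_cancel]
  rw [← integral_Ici_eq_integral_Ioi]
  refine setIntegral_eq_integral_of_forall_compl_eq_zero fun t ht => ?_
  rw [kernel_eq_zero hq fun h => ht ?_, zero_mul]
  have := (abs_le.1 h).2
  simp only [mem_Ici]; linarith

theorem integral_kernel_mul_laguerre (hd : 0 ≤ d) (hq : IsPotential d q) (n : ℕ) (x : ℝ) :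
    ∫ y, kernel q x y * (laguerre n (x - y) : ℂ) = ∑ j ∈ Finset.range (n + 1),
      (-1) ^ j * (∫ y, kernel q x y * (y : ℂ) ^ j) * ∑ k ∈ Finset.Icc j n,
        (-1) ^ k * ((n.factorial : ℂ) /
          ((n - k).factorial * k.factorial * (k - j).factorial * j.factorial)) *
          (x : ℂ) ^ (k - j) := by
  have hL : ∀ y : ℝ, kernel q x y * (laguerre n (x - y) : ℂ) =
      ∑ k ∈ Finset.range (n + 1), ∑ j ∈ Finset.range (k + 1),
        ((laguerreCoeff n k : ℂ) * ((-1) ^ j * (x : ℂ) ^ (k - j) * k.choose j)) *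
          (kernel q x y * (y : ℂ) ^ j) := by
    intro y
    rw [laguerre_eq]
    push_cast
    rw [Finset.mul_sum]
    refine Finset.sum_congr rfl fun k _ => ?_
    rw [sub_eq_neg_add, add_pow, Finset.mul_sum, Finset.mul_sum]
    refine Finset.sum_congr rfl fun j _ => ?_
    rw [neg_pow (y : ℂ)]
    ring
  have hi : ∀ j : ℕ, Integrable fun y : ℝ => kernel q x y * (y : ℂ) ^ j := fun j =>
    integrable_kernel_mul hd hq (by fun_prop) x
  simp_rw [hL]
  rw [integral_finsetSum _ fun k _ => integrable_finsetSum _ fun j _ => (hi j).const_mul _]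
  simp_rw [integral_finsetSum _ fun j _ => (hi j).const_mul _, integral_const_mul, Finset.mul_sum]
  -- The powers of `y` are collected; the product of the two binomials with `1 / k!` is the stated
  -- factorial quotient.
  rw [Finset.sum_comm' (t' := Finset.range (n + 1)) (s' := fun j => Finset.Icc j n)
    (fun k j => by simp only [Finset.mem_range, Finset.mem_Icc]; omega)]
  refine Finset.sum_congr rfl fun j _ => Finset.sum_congr rfl fun k hk => ?_
  obtain ⟨hjk, hkn⟩ := Finset.mem_Icc.1 hk
  rw [laguerreCoeff]
  push_cast
  rw [Nat.cast_choose ℂ hjk, Nat.cast_choose ℂ hkn]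
  have h1 : (k.factorial : ℂ) ≠ 0 := by exact_mod_cast k.factorial_ne_zero
  have h2 : (j.factorial : ℂ) ≠ 0 := by exact_mod_cast j.factorial_ne_zero
  have h3 : ((k - j).factorial : ℂ) ≠ 0 := by exact_mod_cast (k - j).factorial_ne_zero
  have h4 : ((n - k).factorial : ℂ) ≠ 0 := by exact_mod_cast (n - k).factorial_ne_zero
  field_simp

end FourierLaguerre

theorem mainTheorem3 (d : ℝ) (hd : 0 < d) (q : ℝ → ℝ) (hq : IntegrableOn q (Ioo 0 d))
    (u : ℝ → ℝ → ℂ)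
    (hu : ∀ ω : ℝ,
      FourierLaguerre.SolvesIVP q d ((ω : ℂ) ^ 2) 1 (-Complex.I * ω) (u ω))
    (f₀ f₁ : ℝ → ℂ)
    (hf₀ : FourierLaguerre.SolvesIVP q d 0 1 0 f₀)
    (hf₁ : FourierLaguerre.SolvesIVP q d 0 0 1 f₁) :
    (∃ A : ℝ → ℝ → ℂ, FourierLaguerre.IsTransmutationKernel d u A) ∧
    ∀ A : ℝ → ℝ → ℂ, FourierLaguerre.IsTransmutationKernel d u A →
      ∀ x ∈ Icc 0 d, ∀ a : ℕ → ℂ,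
        FourierLaguerre.HasLaguerreExpansion
            (fun t => A x (x - t) * Complex.exp (t : ℂ)) a ↔
          ∀ n : ℕ, a n =
            ∑ j ∈ Finset.range (n + 1),
              (-1) ^ j * (FourierLaguerre.phi d f₀ f₁ j x - (x : ℂ) ^ j) *
                ∑ k ∈ Finset.Icc j n,
                  (-1) ^ k * ((n.factorial : ℂ) /
                    ((n - k).factorial * k.factorial * (k - j).factorial * j.factorial)) *
                    (x : ℂ) ^ (k - j) := by
  obtain ⟨q', hq', hqq⟩ := FourierLaguerre.exists_isPotential hq
  have hK := FourierLaguerre.isTransmutationKernel_kernel hd.le hq' fun ω => (hu ω).congr hqq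
  refine ⟨⟨_, hK⟩, fun A hA x hx a => ?_⟩
  -- An arbitrary kernel may be replaced by the constructed one, since only almost everywhere
  -- classes enter the expansion.
  have hae := FourierLaguerre.ae_laguerreMeasure_comp_sub (hA.ae_eq hK hx)
  have hmem : MemLp (fun t : ℝ => A x (x - t) * Complex.exp (t : ℂ)) 2
      FourierLaguerre.laguerreMeasure := by
    refine (FourierLaguerre.memLp_kernel_mul_exp hd.le hq' x).ae_eq ?_
    filter_upwards [hae] with t ht
    rw [ht]
  rw [FourierLaguerre.hasLaguerreExpansion_iff hmem]
  refine forall_congr' fun n => ?_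
  have hn : ∫ t, (FourierLaguerre.laguerre n t : ℂ) * (A x (x - t) * Complex.exp (t : ℂ))
      ∂FourierLaguerre.laguerreMeasure = ∫ t, (FourierLaguerre.laguerre n t : ℂ) *
        (FourierLaguerre.kernel q' x (x - t) * Complex.exp (t : ℂ))
        ∂FourierLaguerre.laguerreMeasure := by
    refine integral_congr_ae ?_
    filter_upwards [hae] with t ht
    rw [ht]
  rw [hn, FourierLaguerre.integral_laguerre_mul_kernel hq',
    FourierLaguerre.integral_kernel_mul_laguerre hd.le hq']
  simp only [FourierLaguerre.phi_eq_integral_kernel hd.le hq' (hf₀.congr hqq) (hf₁.congr hqq) _ hx,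
    add_sub_cancel_left]
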